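/- Let $X=(x_n)_{n\ge 1}$ be a sequence of positive real numbers such that, for some constant $c>0$, $x_{n+1}-x_n\ge c$ for all $n\ge1$. For $N\ge 1$ let $$E^*(X,N)=\#\{(n_1,n_2,n_3,n_4)\in\{1,\dots,N\}^4:\ |x_{n_1}+x_{n_2}-x_{n_3}-x_{n_4}|<1\},$$ and for $\alpha\in\mathbb R$ and $N\ge 2$ let $$\delta_{\min}^{\alpha}(N)=\min\{\|\alpha x_m-\alpha x_n\|:\ 1\le m,n\le N,\ m\ne n\},\qquad \|t\|=\min_{k\in\mathbb Z}|t-k|.$$ Assume that $E^*(X,N)=N^{2+o(1)}$ as $N\to\infty$. Let $\kappa\ge 2$ and $m(\kappa)$ be real numbers such that for every $\varepsilon>0$, as $T\to\infty$, $$\frac1T\int_0^T\left|\zeta\left(\tfrac12+it\right)\right|^{\kappa}\,dt\ \ll_{\varepsilon}\ T^{m(\kappa)+\varepsilon}.$$ Then for Lebesgue-almost every $\alpha\in\mathbb R$, $$\delta_{\min}^{\alpha}(N)<\frac{1}{N^{\frac{2\kappa-4}{\kappa+4m(\kappa)}-o(1)}}\qquad(N\to\infty),$$ where the rate of decay of $o(1)$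 may depend on $\alpha$. In particular, if the moment bound holds with $\kappa=12$ and $m(12)=1$ (which is Heath-Brown's twelfth moment bound), then $\delta_{\min}^{\alpha}(N)<N^{-5/4+o(1)}$ for almost every $\alpha\in\mathbb R$. -/

import Mathlib

open Filter Topology MeasureTheory Asymptotics

noncomputable section

/-- The distance `‖t‖ = min_{k ∈ ℤ} |t - k|` of a real number to the nearest integer. -/
def distNearestInt (t : ℝ) : ℝ := |t - round t|

theorem distNearestInt_isLeast (t : ℝ) :
    IsLeast (Set.range fun k : ℤ => |t - (k : ℝ)|) (distNearestInt t) :=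
  ⟨⟨round t, rfl⟩, by rintro _ ⟨k, rfl⟩; exact round_le t k⟩

/-- The set of gaps `‖x_m - x_n‖`, over `1 ≤ m, n ≤ N` with `m ≠ n`. -/
def gapSet (x : ℕ → ℝ) (N : ℕ) : Set ℝ :=
  {d | ∃ m ∈ Finset.Icc 1 N, ∃ n ∈ Finset.Icc 1 N, m ≠ n ∧ d = distNearestInt (x m - x n)}

/-- The minimal gap `δ_min((x_n)_{n ≥ 1}, N)`; for `N ≥ 2` the infimum is a minimum. -/
def minGap (x : ℕ → ℝ) (N : ℕ) : ℝ := sInf (gapSet x N)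

theorem minGap_isLeast (x : ℕ → ℝ) {N : ℕ} (hN : 2 ≤ N) :
    IsLeast (gapSet x N) (minGap x N) := by
  have hfin : (gapSet x N).Finite := by
    refine ((Finset.Icc 1 N ×ˢ Finset.Icc 1 N).finite_toSet.image
      (fun p : ℕ × ℕ => distNearestInt (x p.1 - x p.2))).subset ?_
    rintro d ⟨m, hm, n, hn, -, rfl⟩
    exact ⟨(m, n), Finset.mem_coe.2 (Finset.mk_mem_product hm hn), rfl⟩
  have hne : (gapSet x N).Nonempty :=
    ⟨_, 1, Finset.mem_Icc.2 ⟨le_rfl, by omega⟩, 2, Finset.mem_Icc.2 ⟨by omega, hN⟩,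
      by omega, rfl⟩
  exact ⟨hne.csInf_mem hfin, fun _ hd => csInf_le hfin.bddBelow hd⟩

/-- The metric minimal gap `δ_min^α(N)`: the minimal gap of `(α x_n)_{n ≥ 1}`. -/
def metricMinGap (x : ℕ → ℝ) (α : ℝ) (N : ℕ) : ℝ := minGap (fun n => α * x n) N

open Classical in
/-- The additive energy `E*(X, N, γ)`: the number of `(n₁, n₂, n₃, n₄) ∈ [1, N]⁴` with
`|x_{n₁} + x_{n₂} - x_{n₃} - x_{n₄}| < γ`. -/
def addEnergyAt (x : ℕ → ℝ) (N : ℕ) (γ : ℝ) : ℕ :=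
  ((Finset.Icc 1 N ×ˢ Finset.Icc 1 N ×ˢ Finset.Icc 1 N ×ˢ Finset.Icc 1 N).filter
    fun q : ℕ × ℕ × ℕ × ℕ => |x q.1 + x q.2.1 - x q.2.2.1 - x q.2.2.2| < γ).card

/-- `E*(X, N) = E*(X, N, 1)`. -/
def addEnergy (x : ℕ → ℝ) (N : ℕ) : ℕ := addEnergyAt x N 1

/-- `(1/T) ∫₀ᵀ |ζ(1/2 + it)|^κ dt ≪_ε T^{m + ε}` as `T → ∞`, for every `ε > 0`. -/
def ZetaMomentBound (κ m : ℝ) : Prop :=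
  ∀ ε : ℝ, 0 < ε →
    (fun T : ℝ => (1 / T) * ∫ t in (0 : ℝ)..T, ‖riemannZeta (1 / 2 + Complex.I * (t : ℂ))‖ ^ κ)
      =O[atTop] (fun T : ℝ => T ^ (m + ε))

/-- For almost all `α`, `δ_min^α(N) < 1 / N^{e - o(1)}` as `N → ∞`; the `o(1)` may depend
on `α`. -/
def AEMinGapBound (x : ℕ → ℝ) (e : ℝ) : Prop :=
  ∀ᵐ α : ℝ ∂volume, ∃ o : ℕ → ℝ, Tendsto o atTop (𝓝 0) ∧
    ∀ᶠ N : ℕ in atTop, metricMinGap x α N < 1 / (N : ℝ) ^ (e - o N)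

end

open ProbabilityTheory

/-!
Let `‖t‖` be the distance to the nearest integer. If `‖α x_m - α x_n‖ ≥ N ^ (-τ)` for all `m ≠ n`,
then a Fejér-type kernel with frequencies below `N ^ a`, where `a` is slightly larger than `τ`,
shows that the sum of `cos (2π j α (x_m - x_n))` over some dyadic block `j ∈ [K, 2K)` and over the
pairs `(m, n)` is very negative. A second moment over a Gaussian random `α` bounds the probability
of this event by the number of solutions of `j d - l d' = O(N ^ ε)` with `j, l ∈ [K, 2K)` and
differences `d, d'` of terms of the sequence. Bounding the additive energy leaves a positive
proportion of the pairs with `d ≥ B`, for any power `B` of `N` with exponent below `2`, so only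
such `d` are needed.

For them the equation says `log j - log l + log d - log d' = O(1 / T)` for `T ≤ K B / N ^ ε`, and
`T` is taken slightly larger than `K²`. Sorting the `d` into logarithmic windows of length `1 / T`,
and applying Cauchy-Schwarz and the additive energy within each window, reduces the count to a
Gaussian average over `|t| ≲ T` of `|∑ j ^ (-it)|² |∑ v k e^(-ikt/T)|²`. The smoothed sum over `j`
is `√K` times a local average of `ζ(1/2 + it)`, up to a pole term supported near `t = 0`, and the
`κ`-th moment controls how often it exceeds a given size. The bound saves a power of `N` as long as
`τ (κ + 4m) < 2κ - 4`. Borel-Cantelli along `N = 2 ^ l` and monotonicity in `N` conclude.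
-/

/-! ### Approximation of `ζ` by Dirichlet polynomials -/

/-- The remainder `∫_a^∞ {x} x^(-s-1) dx` of Euler summation for the Dirichlet series of `ζ`. -/
noncomputable def fractTail (a : ℝ) (s : ℂ) : ℂ :=
  ∫ x in Set.Ioi a, ((Int.fract x : ℝ) : ℂ) * (x : ℂ) ^ (-s - 1)

theorem norm_ofReal_fract_le_one (x : ℝ) : ‖((Int.fract x : ℝ) : ℂ)‖ ≤ 1 := by
  rw [Complex.norm_real, Real.norm_of_nonneg (Int.fract_nonneg x)]
  exact (Int.fract_lt_one x).le

theorem measurable_ofReal_fract : Measurable fun x : ℝ => ((Int.fract x : ℝ) : ℂ) :=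
  Complex.measurable_ofReal.comp measurable_fract

theorem integrableOn_fract_mul_cpow {s : ℂ} (hs : 0 < s.re) {a : ℝ} (ha : 0 < a) :
    IntegrableOn (fun x : ℝ => ((Int.fract x : ℝ) : ℂ) * (x : ℂ) ^ (-s - 1)) (Set.Ioi a) :=
  (integrableOn_Ioi_cpow_of_lt (by simp; linarith) ha).bdd_mul (c := 1)
    measurable_ofReal_fract.aestronglyMeasurable (Eventually.of_forall norm_ofReal_fract_le_one)

theorem norm_fractTail_le {s : ℂ} (hs : 0 < s.re) {a : ℝ} (ha : 0 < a) :
    ‖fractTail a s‖ ≤ a ^ (-s.re) / s.re := by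
  have hint : ∫ x in Set.Ioi a, x ^ (-s.re - 1) = a ^ (-s.re) / s.re := by
    rw [integral_Ioi_rpow_of_lt (by linarith) ha]
    simp [neg_div, div_neg]
  rw [← hint]
  refine norm_integral_le_of_norm_le (integrableOn_Ioi_rpow_of_lt (by linarith) ha) ?_
  filter_upwards [ae_restrict_mem measurableSet_Ioi] with x hx
  rw [norm_mul, Complex.norm_cpow_eq_rpow_re_of_pos (ha.trans hx)]
  exact mul_le_of_le_one_left (Real.rpow_nonneg (ha.trans hx).le _) (norm_ofReal_fract_le_one x)

theorem fractTail_one_eq_mellin (s : ℂ) :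
    fractTail 1 s =
      mellin (Set.indicator (Set.Ioi 1) fun x : ℝ => ((Int.fract x : ℝ) : ℂ)) (-s) := by
  rw [mellin, fractTail, ← Set.inter_eq_self_of_subset_right
    (Set.Ioi_subset_Ioi zero_le_one : Set.Ioi (1 : ℝ) ⊆ Set.Ioi 0),
    ← setIntegral_indicator measurableSet_Ioi]
  congr 1 with x
  by_cases hx : x ∈ Set.Ioi (1 : ℝ) <;> simp [hx, mul_comm]

theorem differentiableOn_fractTail_one : DifferentiableOn ℂ (fractTail 1) {s | 0 < s.re} := by
  intro s (hs : 0 < s.re)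
  set f : ℝ → ℂ := Set.indicator (Set.Ioi 1) fun x => ((Int.fract x : ℝ) : ℂ) with hf
  have hfm : Measurable f := measurable_ofReal_fract.indicator measurableSet_Ioi
  have hfb : ∀ x, ‖f x‖ ≤ 1 := fun x =>
    (norm_indicator_le_norm_self _ _).trans (norm_ofReal_fract_le_one x)
  have hd : DifferentiableAt ℂ (mellin f) (-s) := by
    refine mellin_differentiableAt_of_isBigO_rpow (a := 0) (b := -s.re - 1) ?_ ?_ (by simpa) ?_
      (by simp)
    · exact ((locallyIntegrable_const (1 : ℝ)).mono hfm.aestronglyMeasurable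
        (Eventually.of_forall fun x => by simpa using hfb x)).locallyIntegrableOn _
    · simpa using isBigO_of_le (g := fun _ : ℝ => (1 : ℝ)) atTop fun x => by simpa using hfb x
    · refine (EventuallyEq.isBigO (f₂ := fun _ => (0 : ℂ)) ?_).trans (isBigO_zero _ _)
      filter_upwards [Ioo_mem_nhdsGT (zero_lt_one' ℝ)] with x hx
      simp [hf, hx.2.le]
  rw [funext fractTail_one_eq_mellin]
  exact (hd.comp s differentiable_neg.differentiableAt).differentiableWithinAt

theorem deriv_ofReal_cpow_neg_mul_floor {s : ℂ} (hs : s ≠ 0) {x : ℝ} (hx : 0 < x) :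
    deriv (fun y : ℝ => (y : ℂ) ^ (-s)) x * (⌊x⌋₊ : ℂ) =
      s * (((Int.fract x : ℝ) : ℂ) * (x : ℂ) ^ (-s - 1)) - s * (x : ℂ) ^ (-s) := by
  have hfloor : ((⌊x⌋₊ : ℕ) : ℂ) = x - ((Int.fract x : ℝ) : ℂ) := by
    have h : (⌊x⌋₊ : ℝ) = x - Int.fract x := by
      rw [natCast_floor_eq_intCast_floor hx.le, Int.self_sub_fract]
    exact_mod_cast congrArg (fun r : ℝ => (r : ℂ)) h
  have hsucc : (x : ℂ) ^ (-s) = x * (x : ℂ) ^ (-s - 1) := by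
    have hxc : (x : ℂ) ≠ 0 := by exact_mod_cast hx.ne'
    rw [Complex.cpow_sub _ _ hxc, Complex.cpow_one, mul_div_cancel₀ _ hxc]
  rw [(hasDerivAt_ofReal_cpow_const hx.ne' (neg_ne_zero.2 hs)).deriv, hfloor, hsucc]
  ring

theorem sum_Icc_natCast_cpow_neg_eq_sub_integral {s : ℂ} (hs : s ≠ 0) (n : ℕ) :
    ∑ j ∈ Finset.Icc 1 n, (j : ℂ) ^ (-s) = (n : ℂ) ^ (-s) * n -
      ∫ x in Set.Ioc (1 : ℝ) n, deriv (fun y : ℝ => (y : ℂ) ^ (-s)) x * (⌊x⌋₊ : ℂ) := by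
  have hderiv : ∀ x ∈ Set.Icc (1 : ℝ) n, HasDerivAt (fun y : ℝ => (y : ℂ) ^ (-s))
      (-s * (x : ℂ) ^ (-s - 1)) x := fun x hx =>
    hasDerivAt_ofReal_cpow_const (one_pos.trans_le hx.1).ne' (neg_ne_zero.2 hs)
  have hcont : ContinuousOn (fun x : ℝ => -s * (x : ℂ) ^ (-s - 1)) (Set.Icc 1 n) := fun x hx =>
    ((Complex.continuousAt_ofReal_cpow_const x _
      (Or.inr (one_pos.trans_le hx.1).ne')).const_mul (-s)).continuousWithinAt
  have habel := sum_mul_eq_sub_integral_mul₀' (f := fun x : ℝ => (x : ℂ) ^ (-s))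
    (fun k => if k = 0 then (0 : ℂ) else 1) rfl n
    (fun x hx => (hderiv x hx).differentiableAt)
    ((hcont.integrableOn_compact isCompact_Icc).congr_fun
      (fun x hx => (hderiv x hx).deriv.symm) measurableSet_Icc)
  have hsum : ∀ (f : ℕ → ℂ) (k : ℕ),
      ∑ j ∈ Finset.Icc 0 k, f j * (if j = 0 then (0 : ℂ) else 1) = ∑ j ∈ Finset.Icc 1 k, f j := by
    intro f k
    rw [← Finset.insert_Icc_add_one_left_eq_Icc k.zero_le, Finset.sum_insert (by simp), if_pos rfl,
      mul_zero, zero_add]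
    refine Finset.sum_congr rfl fun j hj => ?_
    rw [if_neg (by have := (Finset.mem_Icc.1 hj).1; omega), mul_one]
  have hcount : ∀ k : ℕ, ∑ j ∈ Finset.Icc 0 k, (if j = 0 then (0 : ℂ) else 1) = k := fun k => by
    simpa using hsum (fun _ => 1) k
  simpa only [hsum, hcount, Complex.ofReal_natCast] using habel

theorem sum_Icc_natCast_cpow_neg {s : ℂ} (hs : 0 < s.re) (hs1 : s ≠ 1) {n : ℕ} (hn : 1 ≤ n) :
    ∑ j ∈ Finset.Icc 1 n, (j : ℂ) ^ (-s) = (n : ℂ) ^ (1 - s) / (1 - s) + s / (s - 1) -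
      s * ∫ x in (1 : ℝ)..n, ((Int.fract x : ℝ) : ℂ) * (x : ℂ) ^ (-s - 1) := by
  have hn1 : (1 : ℝ) ≤ n := by exact_mod_cast hn
  have h1s : 1 - s ≠ 0 := sub_ne_zero.2 hs1.symm
  have h1s' : s - 1 ≠ 0 := sub_ne_zero.2 hs1
  have hs0 : s ≠ 0 := fun h => by simp [h] at hs
  have hn0 : (n : ℂ) ≠ 0 := by exact_mod_cast (by omega : n ≠ 0)
  have h0 : (0 : ℝ) ∉ Set.uIcc (1 : ℝ) n := by simp [Set.uIcc_of_le hn1]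
  have hfract : IntervalIntegrable (fun x : ℝ => ((Int.fract x : ℝ) : ℂ) * (x : ℂ) ^ (-s - 1))
      volume 1 n := by
    rw [intervalIntegrable_iff_integrableOn_Ioc_of_le hn1]
    exact (integrableOn_fract_mul_cpow hs one_pos).mono_set Set.Ioc_subset_Ioi_self
  have hpow : IntervalIntegrable (fun x : ℝ => (x : ℂ) ^ (-s)) volume 1 n :=
    intervalIntegral.intervalIntegrable_cpow (Or.inr h0)
  have hint : ∫ x in Set.Ioc (1 : ℝ) n, deriv (fun y : ℝ => (y : ℂ) ^ (-s)) x * (⌊x⌋₊ : ℂ) =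
      s * (∫ x in (1 : ℝ)..n, ((Int.fract x : ℝ) : ℂ) * (x : ℂ) ^ (-s - 1)) -
        s * (((n : ℂ) ^ (1 - s) - 1) / (1 - s)) := by
    rw [setIntegral_congr_fun measurableSet_Ioc fun x hx =>
        deriv_ofReal_cpow_neg_mul_floor hs0 (one_pos.trans hx.1),
      ← intervalIntegral.integral_of_le hn1,
      intervalIntegral.integral_sub (hfract.const_mul s) (hpow.const_mul s),
      intervalIntegral.integral_const_mul, intervalIntegral.integral_const_mul,
      integral_cpow (Or.inr ⟨fun h => hs1 (neg_injective h), h0⟩), neg_add_eq_sub]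
    simp
  have hsplit : (n : ℂ) ^ (1 - s) = n * (n : ℂ) ^ (-s) := by
    rw [sub_eq_add_neg, Complex.cpow_add _ _ hn0, Complex.cpow_one]
  rw [sum_Icc_natCast_cpow_neg_eq_sub_integral hs0, hint, hsplit]
  field_simp
  ring

theorem tendsto_sum_Icc_natCast_cpow_neg {s : ℂ} (hs : 1 < s.re) :
    Tendsto (fun n : ℕ => ∑ j ∈ Finset.Icc 1 n, (j : ℂ) ^ (-s)) atTop (𝓝 (riemannZeta s)) := by
  have hsum := (LSeriesHasSum_one hs).tendsto_sum_nat.comp (tendsto_add_atTop_nat 1)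
  refine hsum.congr fun n => ?_
  rw [Function.comp_apply, Finset.sum_range_succ', LSeries.term_zero, add_zero,
    Finset.range_eq_Ico, Finset.sum_Ico_add' (fun j => LSeries.term 1 s j) 0 n 1]
  refine Finset.sum_congr (by ext; simp) fun j hj => ?_
  rw [LSeries.term_of_ne_zero (by have := (Finset.mem_Icc.1 hj).1; omega), Complex.cpow_neg]
  simp

theorem riemannZeta_eq_fractTail_of_one_lt_re {s : ℂ} (hs : 1 < s.re) :
    riemannZeta s = s / (s - 1) - s * fractTail 1 s := by
  have hs1 : s ≠ 1 := by rintro rfl; simp at hs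
  have hmain : Tendsto (fun n : ℕ => (n : ℂ) ^ (1 - s) / (1 - s)) atTop (𝓝 (0 / (1 - s))) := by
    refine Tendsto.div_const (tendsto_zero_iff_norm_tendsto_zero.2 ?_) _
    refine ((tendsto_rpow_neg_atTop (sub_pos.2 hs)).comp tendsto_natCast_atTop_atTop).congr' ?_
    filter_upwards [eventually_gt_atTop 0] with n hn
    simp [Complex.norm_natCast_cpow_of_pos hn]
  have hint : Tendsto (fun n : ℕ => ∫ x in (1 : ℝ)..n, ((Int.fract x : ℝ) : ℂ) * (x : ℂ) ^ (-s - 1))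
      atTop (𝓝 (fractTail 1 s)) :=
    intervalIntegral_tendsto_integral_Ioi 1
      (integrableOn_fract_mul_cpow (by linarith) one_pos) tendsto_natCast_atTop_atTop
  refine tendsto_nhds_unique (tendsto_sum_Icc_natCast_cpow_neg hs) ?_
  have hlim := (hmain.add_const (s / (s - 1))).sub (hint.const_mul s)
  rw [zero_div, zero_add] at hlim
  refine hlim.congr' ?_
  filter_upwards [eventually_ge_atTop 1] with n hn
  exact (sum_Icc_natCast_cpow_neg (by linarith) hs1 hn).symm

theorem riemannZeta_eq_fractTail {s : ℂ} (hs : 0 < s.re) (hs1 : s ≠ 1) :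
    riemannZeta s = s / (s - 1) - s * fractTail 1 s := by
  have hopen : ∀ c : ℝ, IsOpen {s : ℂ | c < s.re} := fun c =>
    isOpen_lt continuous_const Complex.continuous_re
  have hζ : AnalyticOnNhd ℂ riemannZeta₁ {s | 0 < s.re} :=
    differentiable_riemannZeta₁.differentiableOn.analyticOnNhd (hopen 0)
  have hF : AnalyticOnNhd ℂ (fun s => s - s * (s - 1) * fractTail 1 s) {s | 0 < s.re} := by
    have := differentiableOn_fractTail_one
    exact DifferentiableOn.analyticOnNhd (by fun_prop) (hopen 0)
  have hev : riemannZeta₁ =ᶠ[𝓝 2] fun s => s - s * (s - 1) * fractTail 1 s := by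
    filter_upwards [(hopen 1).mem_nhds (by simp : (2 : ℂ) ∈ {s : ℂ | 1 < s.re})] with z hz
    have hz1 : z ≠ 1 := by rintro rfl; simp at hz
    have hz2 : z - 1 ≠ 0 := sub_ne_zero.2 hz1
    have h := riemannZeta_eq_inv_sub_mul hz1
    rw [riemannZeta_eq_fractTail_of_one_lt_re hz] at h
    field_simp at h
    linear_combination -h
  have heq := hζ.eqOn_of_preconnected_of_eventuallyEq hF
    (convex_halfSpace_re_gt 0).isPreconnected (by simp) hev hs
  have h1s : s - 1 ≠ 0 := sub_ne_zero.2 hs1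
  rw [riemannZeta_eq_inv_sub_mul hs1, heq]
  field_simp

theorem norm_sum_cpow_sub_sub_riemannZeta_le {s : ℂ} (hs : 0 < s.re) (hs1 : s ≠ 1) {n : ℕ}
    (hn : 1 ≤ n) :
    ‖∑ j ∈ Finset.Icc 1 n, (j : ℂ) ^ (-s) - (n : ℂ) ^ (1 - s) / (1 - s) - riemannZeta s‖ ≤
      ‖s‖ * ((n : ℝ) ^ (-s.re) / s.re) := by
  have hn0 : (0 : ℝ) < n := by exact_mod_cast hn
  have hsplit : ∫ x in (1 : ℝ)..n, ((Int.fract x : ℝ) : ℂ) * (x : ℂ) ^ (-s - 1) =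
      fractTail 1 s - fractTail n s :=
    (intervalIntegral.integral_Ioi_sub_Ioi (integrableOn_fract_mul_cpow hs one_pos)
      (by exact_mod_cast hn)).symm
  have heq : ∑ j ∈ Finset.Icc 1 n, (j : ℂ) ^ (-s) - (n : ℂ) ^ (1 - s) / (1 - s) - riemannZeta s =
      s * fractTail n s := by
    rw [sum_Icc_natCast_cpow_neg hs hs1 hn, riemannZeta_eq_fractTail hs hs1, hsplit]
    ring
  rw [heq, norm_mul]
  exact mul_le_mul_of_nonneg_left (norm_fractTail_le hs hn0) (norm_nonneg s)

theorem integral_cexp_mul_I_gaussianReal (v : NNReal) (a : ℝ) :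
    ∫ y, Complex.exp (a * y * Complex.I) ∂(gaussianReal 0 v) =
      (Real.exp (-(v * a ^ 2) / 2) : ℝ) := by
  have h := charFun_gaussianReal (μ := 0) (v := v) a
  rw [charFun_apply_real] at h
  rw [h]
  push_cast
  congr 1
  ring

/-- The point `1/2 + it` on the critical line. -/
noncomputable def critPt (t : ℝ) : ℂ := 1 / 2 + Complex.I * t

@[simp] theorem critPt_re (t : ℝ) : (critPt t).re = 1 / 2 := by simp [critPt]
@[simp] theorem critPt_im (t : ℝ) : (critPt t).im = t := by simp [critPt]

theorem critPt_ne_one (t : ℝ) : critPt t ≠ 1 := fun h => by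
  have := congrArg Complex.re h
  norm_num at this

theorem continuous_critPt : Continuous critPt := by unfold critPt; fun_prop

theorem norm_critPt_le (t : ℝ) : ‖critPt t‖ ≤ 1 / 2 + |t| := by
  have := Complex.norm_le_abs_re_add_abs_im (critPt t)
  simpa [abs_of_pos] using this

theorem continuous_zeta_critPt : Continuous fun t : ℝ => riemannZeta (critPt t) := by
  refine continuous_iff_continuousAt.2 fun t => ?_
  exact (differentiableAt_riemannZeta (critPt_ne_one t)).continuousAt.comp
    continuous_critPt.continuousAt

theorem half_le_norm_one_sub_critPt (t : ℝ) : 1 / 2 ≤ ‖1 - critPt t‖ := by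
  have := Complex.abs_re_le_norm (1 - critPt t)
  norm_num at this
  linarith

theorem norm_zeta_critPt_le (t : ℝ) : ‖riemannZeta (critPt t)‖ ≤ 4 + 2 * |t| := by
  have hR := norm_sum_cpow_sub_sub_riemannZeta_le (s := critPt t) (by simp) (critPt_ne_one t)
    (n := 1) le_rfl
  simp only [Finset.Icc_self, Finset.sum_singleton, Nat.cast_one, Complex.one_cpow,
    Real.one_rpow, critPt_re, one_div_one_div] at hR
  have hpole : ‖1 / (1 - critPt t)‖ ≤ 2 := by
    have h := half_le_norm_one_sub_critPt t
    rw [norm_div, norm_one, div_le_iff₀ (by linarith)]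
    linarith
  calc ‖riemannZeta (critPt t)‖
      = ‖1 - 1 / (1 - critPt t) - (1 - 1 / (1 - critPt t) - riemannZeta (critPt t))‖ := by
        rw [sub_sub_cancel]
    _ ≤ ‖(1 : ℂ)‖ + ‖1 / (1 - critPt t)‖ + ‖1 - 1 / (1 - critPt t) - riemannZeta (critPt t)‖ :=
        (norm_sub_le _ _).trans (add_le_add_left (norm_sub_le _ _) _)
    _ ≤ 4 + 2 * |t| := by
        rw [norm_one]
        linarith [norm_critPt_le t]

/-! ### Smoothed Dirichlet sums on the critical line -/

/-- The logarithmically smoothed weight `(j/K)^(-1/2) exp(-log²(j/K)/2)`. -/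
noncomputable def logWeight (K : ℝ) (j : ℕ) : ℝ :=
  Real.sqrt K * ((j : ℝ) ^ (-(1 / 2) : ℝ) * Real.exp (-(Real.log K - Real.log j) ^ 2 / 2))

/-- The smoothed Dirichlet polynomial approximating `∑ j ^ (-it)` over `j` of size about `K`. -/
noncomputable def smoothSum (K : ℝ) (n : ℕ) (t : ℝ) : ℂ :=
  ∑ j ∈ Finset.Icc 1 n, (logWeight K j : ℂ) * Complex.exp (-(t * Real.log j : ℝ) * Complex.I)

theorem natCast_cpow_neg_critPt {j : ℕ} (hj : 1 ≤ j) (t : ℝ) :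
    (j : ℂ) ^ (-critPt t) =
      ((j : ℝ) ^ (-(1 / 2) : ℝ) : ℝ) * Complex.exp (-(t * Real.log j : ℝ) * Complex.I) := by
  have hj0 : (0 : ℝ) < j := by exact_mod_cast hj
  have hjc : (j : ℂ) ≠ 0 := by exact_mod_cast hj0.ne'
  rw [Complex.cpow_def_of_ne_zero hjc, Real.rpow_def_of_pos hj0, ← Complex.natCast_log]
  push_cast
  rw [← Complex.exp_add, critPt]
  congr 1
  ring

theorem integral_cexp_mul_cpow_neg_critPt (K : ℝ) {j : ℕ} (hj : 1 ≤ j) (t : ℝ) :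
    Real.sqrt K * ∫ y, Complex.exp (Real.log K * y * Complex.I) * (j : ℂ) ^ (-critPt (t + y))
      ∂(gaussianReal 0 1) =
    (logWeight K j : ℂ) * Complex.exp (-(t * Real.log j : ℝ) * Complex.I) := by
  have h : ∀ y : ℝ, Complex.exp (Real.log K * y * Complex.I) * (j : ℂ) ^ (-critPt (t + y)) =
      (((j : ℝ) ^ (-(1 / 2) : ℝ) : ℝ) * Complex.exp (-(t * Real.log j : ℝ) * Complex.I)) *
        Complex.exp ((Real.log K - Real.log j : ℝ) * y * Complex.I) := by
    intro y
    rw [natCast_cpow_neg_critPt hj, mul_left_comm, mul_assoc (((j : ℝ) ^ (-(1 / 2) : ℝ) : ℝ) : ℂ),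
      ← Complex.exp_add, ← Complex.exp_add]
    congr 2
    push_cast
    ring
  simp_rw [h]
  rw [integral_const_mul, integral_cexp_mul_I_gaussianReal, logWeight]
  push_cast
  simp only [one_mul]
  ring

theorem integrable_abs_gaussianReal (v : NNReal) :
    Integrable (fun y : ℝ => |y|) (gaussianReal 0 v) :=
  ((memLp_id_gaussianReal (μ := 0) (v := v) 1).integrable (by simp)).norm

theorem memLp_of_norm_le_linear {E : Type*} [NormedAddCommGroup E] {f : ℝ → E} {v : NNReal}
    (hf : AEStronglyMeasurable f (gaussianReal 0 v)) (A B : ℝ) (h : ∀ y, ‖f y‖ ≤ A + B * |y|)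
    {p : ENNReal} (hp : p ≠ ⊤) : MemLp f p (gaussianReal 0 v) := by
  have habs : MemLp (fun y : ℝ => |y|) p (gaussianReal 0 v) :=
    (memLp_id_gaussianReal' (μ := 0) (v := v) p hp).norm
  exact ((memLp_const A).add (habs.const_mul B)).mono' hf (Eventually.of_forall h)

theorem integrable_of_norm_le_linear {E : Type*} [NormedAddCommGroup E] {f : ℝ → E} {v : NNReal}
    (hf : AEStronglyMeasurable f (gaussianReal 0 v)) (A B : ℝ) (h : ∀ y, ‖f y‖ ≤ A + B * |y|) :
    Integrable f (gaussianReal 0 v) :=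
  (memLp_of_norm_le_linear hf A B h ENNReal.one_ne_top).integrable le_rfl

theorem norm_cexp_mul_mul_I (a y : ℝ) : ‖Complex.exp (a * y * Complex.I)‖ = 1 := by
  rw [← Complex.ofReal_mul, Complex.norm_exp_ofReal_mul_I]

theorem integrable_cexp_mul_of_norm_le_linear {f : ℝ → ℂ} {v : NNReal} (hf : Continuous f)
    (a A B : ℝ) (h : ∀ y, ‖f y‖ ≤ A + B * |y|) :
    Integrable (fun y : ℝ => Complex.exp (a * y * Complex.I) * f y) (gaussianReal 0 v) :=
  integrable_of_norm_le_linear (Continuous.aestronglyMeasurable (by fun_prop)) A B fun y => by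
    simpa only [norm_mul, norm_cexp_mul_mul_I, one_mul] using h y

theorem continuous_natCast_cpow_neg_critPt {j : ℕ} (hj : j ≠ 0) (t : ℝ) :
    Continuous fun y : ℝ => (j : ℂ) ^ (-critPt (t + y)) :=
  Continuous.const_cpow (continuous_critPt.comp (continuous_const_add t)).neg
    (Or.inl (Nat.cast_ne_zero.2 hj))

theorem norm_natCast_cpow_neg_critPt_le_one {j : ℕ} (hj : 1 ≤ j) (t : ℝ) :
    ‖(j : ℂ) ^ (-critPt t)‖ ≤ 1 := by
  rw [Complex.norm_natCast_cpow_of_pos (by omega)]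
  exact Real.rpow_le_one_of_one_le_of_nonpos (by exact_mod_cast hj) (by simp)

theorem integrable_cexp_mul_cpow_neg_critPt (K : ℝ) {j : ℕ} (hj : 1 ≤ j) (t : ℝ) :
    Integrable (fun y : ℝ => Complex.exp (Real.log K * y * Complex.I) *
      (j : ℂ) ^ (-critPt (t + y))) (gaussianReal 0 1) :=
  integrable_cexp_mul_of_norm_le_linear (continuous_natCast_cpow_neg_critPt (by omega) t) _ 1 0
    fun y => by simpa using norm_natCast_cpow_neg_critPt_le_one hj (t + y)

theorem smoothSum_eq_integral (K : ℝ) (n : ℕ) (t : ℝ) :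
    smoothSum K n t = Real.sqrt K * ∫ y, Complex.exp (Real.log K * y * Complex.I) *
      ∑ j ∈ Finset.Icc 1 n, (j : ℂ) ^ (-critPt (t + y)) ∂(gaussianReal 0 1) := by
  simp_rw [Finset.mul_sum]
  rw [integral_finsetSum _ fun j hj =>
    integrable_cexp_mul_cpow_neg_critPt K (Finset.mem_Icc.1 hj).1 t, Finset.mul_sum, smoothSum]
  exact Finset.sum_congr rfl fun j hj =>
    (integral_cexp_mul_cpow_neg_critPt K (Finset.mem_Icc.1 hj).1 t).symm

/-- The integrand of the main term of the smoothed sum. -/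
noncomputable def mainIntegrand (L t u : ℝ) : ℂ :=
  Complex.exp ((1 / 2 - t * Complex.I) * u) * (Real.exp (-(L - u) ^ 2 / 2) : ℝ)

theorem norm_mainIntegrand (L t u : ℝ) :
    ‖mainIntegrand L t u‖ = Real.exp (u / 2) * Real.exp (-(L - u) ^ 2 / 2) := by
  rw [mainIntegrand, norm_mul, Complex.norm_exp, Complex.norm_real,
    Real.norm_of_nonneg (by positivity)]
  simp
  ring

theorem mainIntegrand_eq (L t u : ℝ) :
    mainIntegrand L t u = Complex.exp ((-(1 / 2) : ℂ) * (u : ℂ) ^ 2 +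
      (1 / 2 - t * Complex.I + L) * u + (-(L : ℂ) ^ 2 / 2)) := by
  rw [mainIntegrand, Complex.ofReal_exp, ← Complex.exp_add]
  congr 1
  push_cast
  ring

theorem integrable_mainIntegrand (L t : ℝ) : Integrable (mainIntegrand L t) := by
  simp_rw [funext (mainIntegrand_eq L t)]
  exact integrable_cexp_quadratic' (by norm_num) _ _

theorem norm_integral_mainIntegrand {K : ℝ} (hK : 0 < K) (t : ℝ) :
    ‖∫ u, mainIntegrand (Real.log K) t u‖ =
      Real.sqrt (2 * Real.pi) * Real.exp (1 / 8) * Real.sqrt K * Real.exp (-t ^ 2 / 2) := by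
  simp_rw [mainIntegrand_eq]
  rw [integral_cexp_quadratic (by norm_num), norm_mul, Complex.norm_exp]
  have h1 : ‖((Real.pi : ℂ) / -(-(1 / 2) : ℂ)) ^ (1 / 2 : ℂ)‖ = Real.sqrt (2 * Real.pi) := by
    have : ((Real.pi : ℂ) / -(-(1 / 2) : ℂ)) = ((2 * Real.pi : ℝ) : ℂ) := by
      push_cast; ring
    rw [this, Complex.norm_cpow_eq_rpow_re_of_pos (by positivity), Real.sqrt_eq_rpow]
    norm_num
  have h2 : Real.sqrt K = Real.exp (Real.log K / 2) := by
    rw [Real.exp_half, Real.exp_log hK]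
  have h3 : -((Real.log K : ℝ) : ℂ) ^ 2 / 2 - (1 / 2 - t * Complex.I + (Real.log K : ℝ)) ^ 2 /
      (4 * -(1 / 2)) = (1 / 8 + Real.log K / 2 - t ^ 2 / 2 : ℝ) +
        (-((1 / 2 + Real.log K) * t) : ℝ) * Complex.I := by
    push_cast
    linear_combination (t ^ 2 / 2 : ℂ) * Complex.I_sq
  have hre : (-((Real.log K : ℝ) : ℂ) ^ 2 / 2 - (1 / 2 - t * Complex.I + (Real.log K : ℝ)) ^ 2 /
      (4 * -(1 / 2))).re = 1 / 8 + Real.log K / 2 - t ^ 2 / 2 := by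
    rw [h3, Complex.add_re, Complex.ofReal_re, Complex.re_ofReal_mul, Complex.I_re, mul_zero,
      add_zero]
  rw [h1, h2, hre, mul_assoc, mul_assoc, ← Real.exp_add, ← Real.exp_add]
  congr 2
  ring

theorem natCast_cpow_div_eq_setIntegral {n : ℕ} (hn : 1 ≤ n) (t : ℝ) :
    (n : ℂ) ^ (1 - critPt t) / (1 - critPt t) =
      ∫ u in Set.Iic (Real.log n), Complex.exp ((1 - critPt t) * u) := by
  have hnc : (n : ℂ) ≠ 0 := by exact_mod_cast (by omega : n ≠ 0)
  rw [integral_exp_mul_complex_Iic (by norm_num), Complex.cpow_def_of_ne_zero hnc,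
    Complex.natCast_log, mul_comm]

theorem integral_cexp_mul_cpow_div (K : ℝ) {n : ℕ} (hn : 1 ≤ n) (t : ℝ) :
    ∫ y, Complex.exp (Real.log K * y * Complex.I) *
      ((n : ℂ) ^ (1 - critPt (t + y)) / (1 - critPt (t + y))) ∂(gaussianReal 0 1) =
    ∫ u in Set.Iic (Real.log n), mainIntegrand (Real.log K) t u := by
  simp_rw [natCast_cpow_div_eq_setIntegral hn, ← integral_const_mul]
  have hpt : ∀ y u : ℝ, Complex.exp (Real.log K * y * Complex.I) *
      Complex.exp ((1 - critPt (t + y)) * u) = Complex.exp ((1 / 2 - t * Complex.I) * u) *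
        Complex.exp ((Real.log K - u : ℝ) * y * Complex.I) := by
    intro y u
    rw [← Complex.exp_add, ← Complex.exp_add, critPt]
    congr 1
    push_cast
    ring
  rw [integral_integral_swap]
  · refine integral_congr_ae (Eventually.of_forall fun u => ?_)
    simp only [hpt]
    rw [integral_const_mul, integral_cexp_mul_I_gaussianReal, mainIntegrand]
    simp
  · have h1 : Integrable (fun u : ℝ => Real.exp (1 / 2 * u))
        (volume.restrict (Set.Iic (Real.log n))) := integrableOn_exp_mul_Iic (by norm_num) _
    have h2 := (integrable_const (μ := gaussianReal 0 1) (1 : ℝ)).mul_prod h1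
    refine h2.mono' ?_ (Eventually.of_forall fun p => ?_)
    · simp only [Function.uncurry_def, hpt]
      refine Continuous.aestronglyMeasurable ?_
      fun_prop
    · simp only [Function.uncurry, hpt]
      rw [norm_mul, ← Complex.ofReal_mul, Complex.norm_exp_ofReal_mul_I, Complex.norm_exp]
      simp

/-- The error in approximating `ζ(1/2 + it)` by its Dirichlet polynomial of length `n`, corrected by
the main term `∫_0^n x^(-1/2 - it) dx`. -/
noncomputable def zetaRemainder (n : ℕ) (t : ℝ) : ℂ :=
  ∑ j ∈ Finset.Icc 1 n, (j : ℂ) ^ (-critPt t) - (n : ℂ) ^ (1 - critPt t) / (1 - critPt t) -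
    riemannZeta (critPt t)

theorem norm_zetaRemainder_le {n : ℕ} (hn : 1 ≤ n) (t : ℝ) :
    ‖zetaRemainder n t‖ ≤ 2 * (n : ℝ) ^ (-(1 / 2) : ℝ) * (1 / 2 + |t|) := by
  calc ‖zetaRemainder n t‖
      ≤ ‖critPt t‖ * ((n : ℝ) ^ (-(1 / 2) : ℝ) / (1 / 2)) := by
        simpa only [critPt_re, zetaRemainder] using
          norm_sum_cpow_sub_sub_riemannZeta_le (s := critPt t) (by simp) (critPt_ne_one t) hn
    _ ≤ (1 / 2 + |t|) * ((n : ℝ) ^ (-(1 / 2) : ℝ) / (1 / 2)) := by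
        gcongr
        exact norm_critPt_le t
    _ = 2 * (n : ℝ) ^ (-(1 / 2) : ℝ) * (1 / 2 + |t|) := by ring

theorem continuous_natCast_cpow_div_critPt {n : ℕ} (hn : n ≠ 0) (t : ℝ) :
    Continuous fun y : ℝ => (n : ℂ) ^ (1 - critPt (t + y)) / (1 - critPt (t + y)) := by
  have hcrit : Continuous fun y : ℝ => 1 - critPt (t + y) :=
    continuous_const.sub (continuous_critPt.comp (continuous_const_add t))
  exact (hcrit.const_cpow (Or.inl (Nat.cast_ne_zero.2 hn))).div hcrit fun y =>
    sub_ne_zero.2 (critPt_ne_one _).symm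

theorem integrable_cexp_mul_cpow_div_critPt (a : ℝ) {n : ℕ} (hn : 1 ≤ n) (t : ℝ) :
    Integrable (fun y : ℝ => Complex.exp (a * y * Complex.I) *
      ((n : ℂ) ^ (1 - critPt (t + y)) / (1 - critPt (t + y)))) (gaussianReal 0 1) := by
  refine integrable_cexp_mul_of_norm_le_linear (continuous_natCast_cpow_div_critPt (by omega) t) _
    ((n : ℝ) ^ (1 / 2 : ℝ) * 2) 0 fun y => ?_
  have hden := half_le_norm_one_sub_critPt (t + y)
  have hre : (1 - critPt (t + y)).re = 1 / 2 := by norm_num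
  have hnum : (0 : ℝ) ≤ (n : ℝ) ^ (1 / 2 : ℝ) := by positivity
  rw [norm_div, Complex.norm_natCast_cpow_of_pos (by omega), hre, zero_mul, add_zero,
    div_le_iff₀ (by linarith)]
  nlinarith

theorem continuous_zeta_critPt_add (t : ℝ) :
    Continuous fun y : ℝ => riemannZeta (critPt (t + y)) :=
  continuous_zeta_critPt.comp (continuous_const_add t)

theorem integrable_cexp_mul_zeta_critPt (a t : ℝ) :
    Integrable (fun y : ℝ => Complex.exp (a * y * Complex.I) * riemannZeta (critPt (t + y)))
      (gaussianReal 0 1) :=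
  integrable_cexp_mul_of_norm_le_linear (continuous_zeta_critPt_add t) _ (4 + 2 * |t|) 2
    fun y => by linarith [norm_zeta_critPt_le (t + y), abs_add_le t y]

theorem continuous_zetaRemainder_add {n : ℕ} (hn : n ≠ 0) (t : ℝ) :
    Continuous fun y : ℝ => zetaRemainder n (t + y) :=
  ((continuous_finsetSum _ fun _ hj => continuous_natCast_cpow_neg_critPt
    (Nat.one_le_iff_ne_zero.1 (Finset.mem_Icc.1 hj).1) t).sub
      (continuous_natCast_cpow_div_critPt hn t)).sub (continuous_zeta_critPt_add t)

theorem norm_zetaRemainder_add_le {n : ℕ} (hn : 1 ≤ n) (t y : ℝ) :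
    ‖zetaRemainder n (t + y)‖ ≤ 2 * (n : ℝ) ^ (-(1 / 2) : ℝ) * (1 / 2 + |t| + |y|) := by
  refine (norm_zetaRemainder_le hn _).trans (mul_le_mul_of_nonneg_left ?_ (by positivity))
  linarith [abs_add_le t y]

theorem integrable_cexp_mul_zetaRemainder (a : ℝ) {n : ℕ} (hn : 1 ≤ n) (t : ℝ) :
    Integrable (fun y : ℝ => Complex.exp (a * y * Complex.I) * zetaRemainder n (t + y))
      (gaussianReal 0 1) :=
  integrable_cexp_mul_of_norm_le_linear (continuous_zetaRemainder_add (by omega) t) _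
    (2 * (n : ℝ) ^ (-(1 / 2) : ℝ) * (1 / 2 + |t|)) (2 * (n : ℝ) ^ (-(1 / 2) : ℝ))
    fun y => by linarith [norm_zetaRemainder_add_le hn t y]

theorem smoothSum_eq_add (K : ℝ) {n : ℕ} (hn : 1 ≤ n) (t : ℝ) :
    smoothSum K n t = Real.sqrt K * ((∫ u in Set.Iic (Real.log n), mainIntegrand (Real.log K) t u) +
      (∫ y, Complex.exp (Real.log K * y * Complex.I) * riemannZeta (critPt (t + y))
        ∂(gaussianReal 0 1)) +
      ∫ y, Complex.exp (Real.log K * y * Complex.I) * zetaRemainder n (t + y)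
        ∂(gaussianReal 0 1)) := by
  have hmain := integrable_cexp_mul_cpow_div_critPt (Real.log K) hn t
  have hzeta := integrable_cexp_mul_zeta_critPt (Real.log K) t
  rw [← integral_cexp_mul_cpow_div K hn t, ← integral_add hmain hzeta,
    ← integral_add (by exact hmain.add hzeta) (integrable_cexp_mul_zetaRemainder _ hn t),
    smoothSum_eq_integral]
  congr 2 with y
  simp only [zetaRemainder]
  ring

theorem norm_integral_cexp_mul_zetaRemainder_le (a : ℝ) {n : ℕ} (hn : 1 ≤ n) (t : ℝ) :
    ‖∫ y, Complex.exp (a * y * Complex.I) * zetaRemainder n (t + y) ∂(gaussianReal 0 1)‖ ≤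
      2 * (n : ℝ) ^ (-(1 / 2) : ℝ) * (1 / 2 + |t| + ∫ y, |y| ∂(gaussianReal 0 1)) := by
  have habs := integrable_abs_gaussianReal 1
  have heq : 2 * (n : ℝ) ^ (-(1 / 2) : ℝ) * (1 / 2 + |t| + ∫ y, |y| ∂(gaussianReal 0 1)) =
      ∫ y, 2 * (n : ℝ) ^ (-(1 / 2) : ℝ) * (1 / 2 + |t| + |y|) ∂(gaussianReal 0 1) := by
    rw [integral_const_mul, integral_add (integrable_const _) habs]
    simp
  rw [heq]
  refine norm_integral_le_of_norm_le (((integrable_const _).add habs).const_mul _) ?_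
  exact Eventually.of_forall fun y => by
    simpa only [norm_mul, norm_cexp_mul_mul_I, one_mul] using norm_zetaRemainder_add_le hn t y

theorem norm_integral_cexp_mul_zeta_le (a t : ℝ) :
    ‖∫ y, Complex.exp (a * y * Complex.I) * riemannZeta (critPt (t + y)) ∂(gaussianReal 0 1)‖ ≤
      ∫ y, ‖riemannZeta (critPt (t + y))‖ ∂(gaussianReal 0 1) := by
  refine (norm_integral_le_integral_norm _).trans (le_of_eq ?_)
  simp only [norm_mul, norm_cexp_mul_mul_I, one_mul]

theorem norm_setIntegral_Iic_mainIntegrand_le {K : ℝ} (hK : 0 < K) (b t : ℝ) :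
    ‖∫ u in Set.Iic b, mainIntegrand (Real.log K) t u‖ ≤
      Real.sqrt (2 * Real.pi) * Real.exp (1 / 8) * Real.sqrt K * Real.exp (-t ^ 2 / 2) +
        ∫ u in Set.Ioi b, ‖mainIntegrand (Real.log K) 0 u‖ := by
  have hadd := integral_add_compl (measurableSet_Iic (a := b))
    (integrable_mainIntegrand (Real.log K) t)
  rw [Set.compl_Iic] at hadd
  rw [← norm_integral_mainIntegrand hK t, eq_sub_of_add_eq hadd]
  refine (norm_sub_le _ _).trans (add_le_add_right ?_ _)
  refine (norm_integral_le_integral_norm _).trans (le_of_eq ?_)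
  simp_rw [norm_mainIntegrand]

/-- The truncation error, uniform in `t` up to a factor `1 + |t|`, in bounding `smoothSum K n` by
`ζ` on the critical line. -/
noncomputable def smoothSumError (K : ℝ) (n : ℕ) : ℝ :=
  Real.sqrt K * ((∫ u in Set.Ioi (Real.log n), ‖mainIntegrand (Real.log K) 0 u‖) +
    2 * (n : ℝ) ^ (-(1 / 2) : ℝ) * (1 + ∫ y, |y| ∂(gaussianReal 0 1)))

theorem tendsto_smoothSumError (K : ℝ) : Tendsto (smoothSumError K) atTop (𝓝 0) := by
  have htail : Tendsto (fun n : ℕ => ∫ u in Set.Ioi (Real.log n),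
      ‖mainIntegrand (Real.log K) 0 u‖) atTop (𝓝 0) :=
    tendsto_integral_Ioi_zero (Real.tendsto_log_atTop.comp tendsto_natCast_atTop_atTop)
  have hpow : Tendsto (fun n : ℕ => (n : ℝ) ^ (-(1 / 2) : ℝ)) atTop (𝓝 0) :=
    (tendsto_rpow_neg_atTop one_half_pos).comp tendsto_natCast_atTop_atTop
  unfold smoothSumError
  simpa only [mul_zero, zero_mul, add_zero] using (htail.add ((hpow.const_mul 2).mul_const
    (1 + ∫ y, |y| ∂(gaussianReal 0 1)))).const_mul (Real.sqrt K)

theorem norm_smoothSum_le {K : ℝ} (hK : 0 < K) {n : ℕ} (hn : 1 ≤ n) (t : ℝ) :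
    ‖smoothSum K n t‖ ≤ Real.sqrt (2 * Real.pi) * Real.exp (1 / 8) * K * Real.exp (-t ^ 2 / 2) +
      Real.sqrt K * ∫ y, ‖riemannZeta (critPt (t + y))‖ ∂(gaussianReal 0 1) +
      smoothSumError K n * (1 + |t|) := by
  have hmain := norm_setIntegral_Iic_mainIntegrand_le hK (Real.log n) t
  have hzeta := norm_integral_cexp_mul_zeta_le (Real.log K) t
  have hrem := norm_integral_cexp_mul_zetaRemainder_le (Real.log K) hn t
  have hA : 0 ≤ ∫ y, |y| ∂(gaussianReal 0 1) := integral_nonneg fun y => abs_nonneg y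
  have hS : 0 ≤ ∫ u in Set.Ioi (Real.log n), ‖mainIntegrand (Real.log K) 0 u‖ :=
    integral_nonneg fun u => norm_nonneg _
  rw [smoothSum_eq_add K hn t, norm_mul, Complex.norm_real,
    Real.norm_of_nonneg (Real.sqrt_nonneg K), smoothSumError]
  refine (mul_le_mul_of_nonneg_left (norm_add₃_le.trans (add_le_add (add_le_add hmain hzeta) hrem))
    (Real.sqrt_nonneg K)).trans ?_
  generalize (∫ y, |y| ∂(gaussianReal 0 1)) = A at *
  generalize (∫ u in Set.Ioi (Real.log n), ‖mainIntegrand (Real.log K) 0 u‖) = S at *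
  generalize (∫ y, ‖riemannZeta (critPt (t + y))‖ ∂(gaussianReal 0 1)) = Z
  have hgrow : S + 2 * (n : ℝ) ^ (-(1 / 2) : ℝ) * (1 / 2 + |t| + A) ≤
      (S + 2 * (n : ℝ) ^ (-(1 / 2) : ℝ) * (1 + A)) * (1 + |t|) := by
    have h : 0 ≤ S * |t| + 2 * (n : ℝ) ^ (-(1 / 2) : ℝ) * (1 / 2 + A * |t|) := by positivity
    linarith
  have hscale := mul_le_mul_of_nonneg_left hgrow (Real.sqrt_nonneg K)
  linear_combination hscale + (Real.sqrt (2 * Real.pi) * Real.exp (1 / 8) * Real.exp (-t ^ 2 / 2)) *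
    Real.mul_self_sqrt hK.le

/-! ### The Gaussian form in the frequencies `log j + k / T` -/

theorem norm_sq_exp_sum {ι : Type*} (s : Finset ι) (a θ : ι → ℝ) (t : ℝ) :
    ((‖∑ i ∈ s, (a i : ℂ) * Complex.exp (-(t * θ i : ℝ) * Complex.I)‖ ^ 2 : ℝ) : ℂ) =
      ∑ i ∈ s, ∑ j ∈ s, ((a i * a j : ℝ) : ℂ) *
        Complex.exp ((θ j - θ i : ℝ) * t * Complex.I) := by
  rw [Complex.ofReal_pow, ← Complex.mul_conj', map_sum, Finset.sum_mul_sum]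
  refine Finset.sum_congr rfl fun i _ => Finset.sum_congr rfl fun j _ => ?_
  rw [map_mul, Complex.conj_ofReal, ← Complex.exp_conj, mul_mul_mul_comm, ← Complex.exp_add,
    ← Complex.ofReal_mul]
  congr 2
  rw [map_mul, map_neg, Complex.conj_ofReal, Complex.conj_I]
  push_cast
  ring

theorem integral_norm_sq_exp_sum_gaussianReal {ι : Type*} (s : Finset ι) (a θ : ι → ℝ)
    (v : NNReal) :
    ∫ t, ‖∑ i ∈ s, (a i : ℂ) * Complex.exp (-(t * θ i : ℝ) * Complex.I)‖ ^ 2 ∂(gaussianReal 0 v) =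
      ∑ i ∈ s, ∑ j ∈ s, a i * a j * Real.exp (-(v * (θ i - θ j) ^ 2) / 2) := by
  have hint : ∀ i j, Integrable (fun t : ℝ => ((a i * a j : ℝ) : ℂ) *
      Complex.exp ((θ j - θ i : ℝ) * t * Complex.I)) (gaussianReal 0 v) := fun i j => by
    refine (integrable_of_norm_le_linear (Continuous.aestronglyMeasurable (by fun_prop)) 1 0
      fun t => ?_).const_mul _
    rw [norm_cexp_mul_mul_I, zero_mul, add_zero]
  rw [← Complex.ofReal_inj, ← integral_complex_ofReal]
  simp_rw [norm_sq_exp_sum]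
  rw [integral_finsetSum _ fun i _ => integrable_finsetSum _ fun j _ => hint i j,
    Complex.ofReal_sum]
  refine Finset.sum_congr rfl fun i _ => ?_
  rw [integral_finsetSum _ fun j _ => hint i j, Complex.ofReal_sum]
  refine Finset.sum_congr rfl fun j _ => ?_
  rw [integral_const_mul, integral_cexp_mul_I_gaussianReal, ← Complex.ofReal_mul, ← neg_sub, neg_sq]

theorem norm_exp_sum_le {ι : Type*} (s : Finset ι) {a : ι → ℝ} (ha : ∀ i ∈ s, 0 ≤ a i)
    (θ : ι → ℝ) (t : ℝ) :
    ‖∑ i ∈ s, (a i : ℂ) * Complex.exp (-(t * θ i : ℝ) * Complex.I)‖ ≤ ∑ i ∈ s, a i := by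
  refine (norm_sum_le _ _).trans (Finset.sum_le_sum fun i hi => ?_)
  rw [norm_mul, ← Complex.ofReal_neg, Complex.norm_exp_ofReal_mul_I, Complex.norm_real,
    Real.norm_of_nonneg (ha i hi), mul_one]

theorem logWeight_nonneg (K : ℝ) (j : ℕ) : 0 ≤ logWeight K j := by
  unfold logWeight; positivity

theorem logWeight_eq_exp {K : ℝ} (hK : 0 < K) {j : ℕ} (hj : 0 < j) :
    logWeight K j =
      Real.exp (-((Real.log j - Real.log K) / 2 + (Real.log j - Real.log K) ^ 2 / 2)) := by
  have hj' : (0 : ℝ) < j := Nat.cast_pos.2 hj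
  rw [logWeight, Real.sqrt_eq_rpow, Real.rpow_def_of_pos hK, Real.rpow_def_of_pos hj',
    ← Real.exp_add, ← Real.exp_add]
  congr 1
  ring

theorem half_le_logWeight {K j : ℕ} (hK : 1 ≤ K) (hj : j ∈ Finset.Ico K (2 * K)) :
    1 / 2 ≤ logWeight K j := by
  obtain ⟨h1, h2⟩ := Finset.mem_Ico.1 hj
  have hK0 : (0 : ℝ) < K := by exact_mod_cast hK
  have hj0 : 0 < j := by omega
  have hl0 : 0 ≤ Real.log j - Real.log K :=
    sub_nonneg.2 (Real.log_le_log hK0 (by exact_mod_cast h1))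
  have hl1 : Real.log j - Real.log K ≤ Real.log 2 := by
    rw [sub_le_iff_le_add, ← Real.log_mul two_ne_zero hK0.ne']
    exact Real.log_le_log (by exact_mod_cast hj0) (by exact_mod_cast h2.le)
  have hlog2 := Real.log_two_lt_d9
  rw [logWeight_eq_exp hK0 hj0, ← Real.exp_log (show (0 : ℝ) < 1 / 2 by norm_num),
    Real.exp_le_exp, one_div, Real.log_inv]
  nlinarith

theorem integrable_rpow_of_norm_le_linear {E : Type*} [NormedAddCommGroup E] {f : ℝ → E}
    {v : NNReal} (hf : AEStronglyMeasurable f (gaussianReal 0 v)) (A B : ℝ)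
    (h : ∀ y, ‖f y‖ ≤ A + B * |y|) {κ : ℝ} (hκ : 0 < κ) :
    Integrable (fun u => ‖f u‖ ^ κ) (gaussianReal 0 v) := by
  have hp := (memLp_of_norm_le_linear hf A B h ENNReal.ofReal_ne_top).integrable_norm_rpow
    (ENNReal.ofReal_pos.2 hκ).ne' ENNReal.ofReal_ne_top
  rwa [ENNReal.toReal_ofReal hκ.le] at hp

theorem integrable_zeta_add_rpow_gaussianReal {κ : ℝ} (hκ : 0 < κ) (t : ℝ) (v : NNReal) :
    Integrable (fun y => ‖riemannZeta (critPt (t + y))‖ ^ κ) (gaussianReal 0 v) :=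
  integrable_rpow_of_norm_le_linear (continuous_zeta_critPt_add t).aestronglyMeasurable
    (4 + 2 * |t|) 2 (fun y => by linarith [norm_zeta_critPt_le (t + y), abs_add_le t y]) hκ

/-- The `κ`-th moment of `ζ` on the critical line in a Gaussian window of width `1` at `t`. -/
noncomputable def localMoment (κ t : ℝ) : ℝ :=
  ∫ y, ‖riemannZeta (critPt (t + y))‖ ^ κ ∂(gaussianReal 0 1)

theorem localMoment_nonneg (κ t : ℝ) : 0 ≤ localMoment κ t :=
  integral_nonneg fun _ => Real.rpow_nonneg (norm_nonneg _) κ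

/-- The `κ`-th moment of `ζ` on the critical line in a Gaussian window centred at `0`, of variance
`T ^ 2 + 1`; the extra `1` makes it the average of `localMoment κ` over a window of width `T`. -/
noncomputable def gaussianMoment (κ T : ℝ) : ℝ :=
  ∫ u, ‖riemannZeta (critPt u)‖ ^ κ ∂(gaussianReal 0 ((T ^ 2).toNNReal + 1))

theorem gaussianMoment_nonneg (κ T : ℝ) : 0 ≤ gaussianMoment κ T :=
  integral_nonneg fun _ => Real.rpow_nonneg (norm_nonneg _) κ

theorem integrable_zeta_rpow_conv {κ : ℝ} (hκ : 0 < κ) (v w : NNReal) :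
    Integrable (fun u => ‖riemannZeta (critPt u)‖ ^ κ) (gaussianReal 0 v ∗ gaussianReal 0 w) := by
  rw [gaussianReal_conv_gaussianReal, add_zero]
  simpa only [zero_add] using integrable_zeta_add_rpow_gaussianReal hκ 0 (v + w)

theorem integrable_localMoment {κ : ℝ} (hκ : 0 < κ) (v : NNReal) :
    Integrable (localMoment κ) (gaussianReal 0 v) := by
  have h := integrable_zeta_rpow_conv hκ v 1
  refine ((integrable_conv_iff h.aestronglyMeasurable).1 h).2.congr
    (Eventually.of_forall fun t => ?_)
  simp only [localMoment, Real.norm_of_nonneg (Real.rpow_nonneg (norm_nonneg _) κ)]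

theorem integral_localMoment {κ : ℝ} (hκ : 0 < κ) (T : ℝ) :
    ∫ t, localMoment κ t ∂(gaussianReal 0 (T ^ 2).toNNReal) = gaussianMoment κ T := by
  have h := integral_conv (integrable_zeta_rpow_conv hκ (T ^ 2).toNNReal 1)
  rw [gaussianReal_conv_gaussianReal, add_zero] at h
  exact h.symm

theorem sq_le_add_rpow {z L κ : ℝ} (hz : 0 ≤ z) (hL : 0 < L) (hκ : 2 ≤ κ) :
    z ^ 2 ≤ L + L ^ (1 - κ / 2) * z ^ κ := by
  rcases le_or_gt (z ^ 2) L with h | h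
  · exact h.trans (le_add_of_nonneg_right (by positivity))
  · have hz0 : 0 < z := hz.lt_of_ne' fun h0 => by simp only [h0] at h; norm_num at h; linarith
    have h1 : z ^ κ = z ^ 2 * (z ^ 2) ^ (κ / 2 - 1) := by
      rw [← Real.rpow_natCast, ← Real.rpow_mul hz, ← Real.rpow_add hz0]
      congr 1
      push_cast
      ring
    have h2 : 1 ≤ L ^ (1 - κ / 2) * (z ^ 2) ^ (κ / 2 - 1) := by
      rw [← neg_sub, Real.rpow_neg hL.le, inv_mul_eq_div, one_le_div (by positivity)]
      exact Real.rpow_le_rpow hL.le h.le (by linarith)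
    rw [h1, mul_left_comm]
    exact (le_mul_of_one_le_right (sq_nonneg z) h2).trans (le_add_of_nonneg_left hL.le)

theorem sq_integral_zeta_le {κ L : ℝ} (hκ : 2 ≤ κ) (hL : 0 < L) (t : ℝ) :
    (∫ y, ‖riemannZeta (critPt (t + y))‖ ∂(gaussianReal 0 1)) ^ 2 ≤
      L + L ^ (1 - κ / 2) * localMoment κ t := by
  have h1 : Integrable (fun y => ‖riemannZeta (critPt (t + y))‖) (gaussianReal 0 1) := by
    simpa only [Real.rpow_one] using integrable_zeta_add_rpow_gaussianReal one_pos t 1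
  have h2 : Integrable (fun y => ‖riemannZeta (critPt (t + y))‖ ^ 2) (gaussianReal 0 1) := by
    simpa only [Real.rpow_two] using integrable_zeta_add_rpow_gaussianReal two_pos t 1
  have hκi := (integrable_zeta_add_rpow_gaussianReal (two_pos.trans_le hκ) t 1).const_mul
    (L ^ (1 - κ / 2))
  calc (∫ y, ‖riemannZeta (critPt (t + y))‖ ∂(gaussianReal 0 1)) ^ 2
      ≤ ∫ y, ‖riemannZeta (critPt (t + y))‖ ^ 2 ∂(gaussianReal 0 1) :=
        even_two.convexOn_pow.map_integral_le (continuous_pow 2).continuousOn isClosed_univ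
          (by simp) h1 h2
    _ ≤ ∫ y, (L + L ^ (1 - κ / 2) * ‖riemannZeta (critPt (t + y))‖ ^ κ) ∂(gaussianReal 0 1) :=
        integral_mono h2 ((integrable_const L).add hκi)
          fun y => sq_le_add_rpow (norm_nonneg _) hL hκ
    _ = L + L ^ (1 - κ / 2) * localMoment κ t := by
        rw [integral_add (integrable_const L) hκi, integral_const_mul, localMoment]
        simp

theorem integral_exp_neg_sq_gaussianReal_le {T : ℝ} (hT : 0 < T) :
    ∫ t, Real.exp (-t ^ 2 / 2) ^ 2 ∂(gaussianReal 0 (T ^ 2).toNNReal) ≤ 1 / T := by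
  have hv : (T ^ 2).toNNReal ≠ 0 := by simp [hT.ne']
  rw [integral_gaussianReal_eq_integral_smul hv]
  have hle : ∀ t : ℝ, gaussianPDFReal 0 (T ^ 2).toNNReal t • Real.exp (-t ^ 2 / 2) ^ 2 ≤
      (√(2 * Real.pi * T ^ 2))⁻¹ * Real.exp (-1 * t ^ 2) := by
    intro t
    rw [gaussianPDFReal, smul_eq_mul, Real.coe_toNNReal _ (sq_nonneg T), mul_assoc]
    refine mul_le_mul_of_nonneg_left ?_ (by positivity)
    rw [← Real.exp_nat_mul]
    have : Real.exp (-(t - 0) ^ 2 / (2 * T ^ 2)) ≤ 1 := by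
      rw [Real.exp_le_one_iff, neg_div]
      exact neg_nonpos.2 (by positivity)
    refine (mul_le_of_le_one_left (Real.exp_nonneg _) this).trans (le_of_eq ?_)
    congr 1
    push_cast
    ring
  refine (integral_mono_of_nonneg (Eventually.of_forall fun t => ?_)
    ((integrable_exp_neg_mul_sq one_pos).const_mul _) (Eventually.of_forall hle)).trans ?_
  · exact smul_nonneg (gaussianPDFReal_nonneg _ _ _) (by positivity)
  · rw [integral_const_mul, integral_gaussian, Real.sqrt_mul (by positivity),
      Real.sqrt_sq hT.le, mul_inv, div_one, mul_right_comm, ← one_div T]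
    refine mul_le_of_le_one_left (by positivity) ?_
    rw [inv_mul_eq_div, div_le_one (by positivity)]
    exact Real.sqrt_le_sqrt (by linarith [Real.pi_pos])

theorem summable_exp_neg_int_sq : Summable fun d : ℤ => Real.exp (-(d : ℝ) ^ 2 / 2) := by
  have h := summable_pow_mul_jacobiTheta₂_term_bound 0
    (show (0 : ℝ) < 1 / (2 * Real.pi) by positivity) 0
  refine h.congr fun d => ?_
  rw [pow_zero, one_mul]
  congr 1
  have := Real.pi_ne_zero
  field_simp
  ring

theorem sum_sum_gaussian_le (S : Finset ℤ) (v : ℤ → ℝ) :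
    ∑ k ∈ S, ∑ l ∈ S, v k * v l * Real.exp (-((k : ℝ) - l) ^ 2 / 2) ≤
      (∑' d : ℤ, Real.exp (-(d : ℝ) ^ 2 / 2)) * ∑ k ∈ S, v k ^ 2 := by
  set g : ℤ → ℤ → ℝ := fun k l => Real.exp (-((k : ℝ) - l) ^ 2 / 2) with hg
  have hsymm : ∀ k l, g k l = g l k := fun k l => by simp only [hg, ← neg_sub (k : ℝ), neg_sq]
  have hrow : ∀ k, ∑ l ∈ S, g k l ≤ ∑' d : ℤ, Real.exp (-(d : ℝ) ^ 2 / 2) := fun k => by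
    have hinj : Set.InjOn (fun l : ℤ => k - l) S := fun a _ b _ h => sub_right_injective h
    simpa only [Finset.sum_image hinj, Int.cast_sub] using summable_exp_neg_int_sq.sum_le_tsum
      (S.image fun l => k - l) fun d _ => Real.exp_nonneg _
  have hrows : ∑ k ∈ S, ∑ l ∈ S, v k ^ 2 * g k l ≤
      (∑' d : ℤ, Real.exp (-(d : ℝ) ^ 2 / 2)) * ∑ k ∈ S, v k ^ 2 := by
    rw [mul_comm, Finset.sum_mul]
    refine Finset.sum_le_sum fun k _ => ?_
    rw [← Finset.mul_sum]
    exact mul_le_mul_of_nonneg_left (hrow k) (sq_nonneg _)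
  have hcols : ∑ k ∈ S, ∑ l ∈ S, v l ^ 2 * g k l = ∑ k ∈ S, ∑ l ∈ S, v k ^ 2 * g k l := by
    rw [Finset.sum_comm]
    exact Finset.sum_congr rfl fun k _ => Finset.sum_congr rfl fun l _ => by rw [hsymm]
  have hamgm : ∀ k l, v k * v l * g k l ≤ 1 / 2 * (v k ^ 2 * g k l) + 1 / 2 * (v l ^ 2 * g k l) :=
    fun k l => by nlinarith [mul_nonneg (Real.exp_nonneg _ : 0 ≤ g k l) (sq_nonneg (v k - v l))]
  refine (Finset.sum_le_sum fun k _ => Finset.sum_le_sum fun l _ => hamgm k l).trans ?_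
  simp_rw [← mul_add, ← Finset.mul_sum _ _ (1 / 2 : ℝ), Finset.sum_add_distrib, hcols]
  linarith

/-- The Gaussian quadratic form in the frequencies `log j + k / T`, with `K ≤ j < 2K`. -/
noncomputable def logForm (T : ℝ) (K : ℕ) (S : Finset ℤ) (v : ℤ → ℝ) : ℝ :=
  ∑ p ∈ Finset.Ico K (2 * K) ×ˢ S, ∑ q ∈ Finset.Ico K (2 * K) ×ˢ S,
    v p.2 * v q.2 * Real.exp (-(T * (Real.log p.1 - Real.log q.1) + (p.2 - q.2)) ^ 2 / 2)

/-- The exponential sum `∑ k ∈ S, v k * exp (-i t k / T)`. -/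
noncomputable def windowSum (T : ℝ) (S : Finset ℤ) (v : ℤ → ℝ) (t : ℝ) : ℂ :=
  ∑ k ∈ S, (v k : ℂ) * Complex.exp (-(t * (k / T) : ℝ) * Complex.I)

theorem continuous_windowSum (T : ℝ) (S : Finset ℤ) (v : ℤ → ℝ) :
    Continuous (windowSum T S v) := by unfold windowSum; fun_prop

theorem norm_windowSum_le (T : ℝ) (S : Finset ℤ) {v : ℤ → ℝ} (hv : ∀ k, 0 ≤ v k) (t : ℝ) :
    ‖windowSum T S v t‖ ≤ ∑ k ∈ S, v k :=
  norm_exp_sum_le S (fun k _ => hv k) _ t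

theorem integral_windowSum_sq_le {T : ℝ} (hT : 0 < T) (S : Finset ℤ) (v : ℤ → ℝ) :
    ∫ t, ‖windowSum T S v t‖ ^ 2 ∂(gaussianReal 0 (T ^ 2).toNNReal) ≤
      (∑' d : ℤ, Real.exp (-(d : ℝ) ^ 2 / 2)) * ∑ k ∈ S, v k ^ 2 := by
  have h := integral_norm_sq_exp_sum_gaussianReal S v (fun k => (k : ℝ) / T) (T ^ 2).toNNReal
  simp only [windowSum]
  rw [h]
  refine le_trans (le_of_eq ?_) (sum_sum_gaussian_le S v)
  refine Finset.sum_congr rfl fun k _ => Finset.sum_congr rfl fun l _ => ?_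
  rw [Real.coe_toNNReal _ (sq_nonneg T)]
  congr 3
  field_simp

theorem norm_smoothSum_mul_windowSum_sq (T : ℝ) (K n : ℕ) (S : Finset ℤ) (v : ℤ → ℝ) (t : ℝ) :
    ‖smoothSum K n t‖ ^ 2 * ‖windowSum T S v t‖ ^ 2 =
      ‖∑ p ∈ Finset.Icc 1 n ×ˢ S, ((logWeight K p.1 * v p.2 : ℝ) : ℂ) *
        Complex.exp (-(t * (Real.log p.1 + p.2 / T) : ℝ) * Complex.I)‖ ^ 2 := by
  rw [← mul_pow, ← norm_mul, smoothSum, windowSum, Finset.sum_mul_sum, Finset.sum_product]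
  congr 2
  refine Finset.sum_congr rfl fun j _ => Finset.sum_congr rfl fun k _ => ?_
  rw [mul_mul_mul_comm, ← Complex.exp_add, ← Complex.ofReal_mul]
  congr 2
  push_cast
  ring

theorem integral_smoothSum_mul_windowSum_sq {T : ℝ} (hT : 0 < T) (K n : ℕ) (S : Finset ℤ)
    (v : ℤ → ℝ) :
    ∫ t, ‖smoothSum K n t‖ ^ 2 * ‖windowSum T S v t‖ ^ 2 ∂(gaussianReal 0 (T ^ 2).toNNReal) =
      ∑ p ∈ Finset.Icc 1 n ×ˢ S, ∑ q ∈ Finset.Icc 1 n ×ˢ S,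
        logWeight K p.1 * v p.2 * (logWeight K q.1 * v q.2) *
          Real.exp (-(T * (Real.log p.1 - Real.log q.1) + (p.2 - q.2)) ^ 2 / 2) := by
  simp_rw [norm_smoothSum_mul_windowSum_sq]
  rw [integral_norm_sq_exp_sum_gaussianReal (Finset.Icc 1 n ×ˢ S)
    (fun p : ℕ × ℤ => logWeight K p.1 * v p.2) (fun p => Real.log p.1 + p.2 / T),
    Real.coe_toNNReal _ (sq_nonneg T)]
  refine Finset.sum_congr rfl fun p _ => Finset.sum_congr rfl fun q _ => ?_
  congr 3
  field_simp
  ring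

theorem add_add_sq_le (a b c : ℝ) : (a + b + c) ^ 2 ≤ 3 * (a ^ 2 + b ^ 2 + c ^ 2) := by
  nlinarith [sq_nonneg (a - b), sq_nonneg (b - c), sq_nonneg (a - c)]

theorem logForm_le_integral {T : ℝ} (hT : 0 < T) {K n : ℕ} (hK : 1 ≤ K) (hn : 2 * K ≤ n)
    (S : Finset ℤ) {v : ℤ → ℝ} (hv : ∀ k, 0 ≤ v k) :
    logForm T K S v ≤ 4 * ∫ t, ‖smoothSum K n t‖ ^ 2 * ‖windowSum T S v t‖ ^ 2
      ∂(gaussianReal 0 (T ^ 2).toNNReal) := by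
  rw [integral_smoothSum_mul_windowSum_sq hT, logForm]
  have hsub : Finset.Ico K (2 * K) ×ˢ S ⊆ Finset.Icc 1 n ×ˢ S :=
    Finset.product_subset_product_left fun j hj => by
      rw [Finset.mem_Ico] at hj
      exact Finset.mem_Icc.2 (by omega)
  have hnonneg : ∀ p q : ℕ × ℤ, 0 ≤ logWeight K p.1 * v p.2 * (logWeight K q.1 * v q.2) *
      Real.exp (-(T * (Real.log p.1 - Real.log q.1) + (p.2 - q.2)) ^ 2 / 2) := fun p q => by
    have := logWeight_nonneg K p.1
    have := logWeight_nonneg K q.1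
    have := hv p.2
    have := hv q.2
    positivity
  have hrows := Finset.sum_le_sum fun p (_ : p ∈ Finset.Ico K (2 * K) ×ˢ S) =>
    Finset.sum_le_sum_of_subset_of_nonneg hsub fun q _ _ => hnonneg p q
  have hall := Finset.sum_le_sum_of_subset_of_nonneg hsub
    fun p _ _ => Finset.sum_nonneg fun q (_ : q ∈ Finset.Icc 1 n ×ˢ S) => hnonneg p q
  refine le_trans ?_ (mul_le_mul_of_nonneg_left (hrows.trans hall) (by norm_num))
  simp_rw [Finset.mul_sum]
  refine Finset.sum_le_sum fun p hp => Finset.sum_le_sum fun q hq => ?_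
  have hpw := half_le_logWeight hK (Finset.mem_product.1 hp).1
  have hqw := half_le_logWeight hK (Finset.mem_product.1 hq).1
  have hweight : 1 / 4 ≤ logWeight K p.1 * logWeight K q.1 := by nlinarith
  rw [← mul_assoc]
  refine mul_le_mul_of_nonneg_right ?_ (Real.exp_nonneg _)
  nlinarith [mul_nonneg (hv p.2) (hv q.2)]

theorem norm_smoothSum_mul_windowSum_sq_le {κ T L : ℝ} (hκ : 2 ≤ κ) (hL : 0 < L) {K n : ℕ}
    (hK : 1 ≤ K) (hn : 1 ≤ n) (S : Finset ℤ) {v : ℤ → ℝ} (hv : ∀ k, 0 ≤ v k) (t : ℝ) :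
    ‖smoothSum K n t‖ ^ 2 * ‖windowSum T S v t‖ ^ 2 ≤
      3 * ((Real.sqrt (2 * Real.pi) * Real.exp (1 / 8)) ^ 2 * K ^ 2 * (∑ k ∈ S, v k) ^ 2) *
          Real.exp (-t ^ 2 / 2) ^ 2 +
        3 * (K * L) * ‖windowSum T S v t‖ ^ 2 +
        3 * (K * L ^ (1 - κ / 2) * (∑ k ∈ S, v k) ^ 2) * localMoment κ t +
        3 * (smoothSumError K n ^ 2 * (∑ k ∈ S, v k) ^ 2) * (1 + |t|) ^ 2 := by
  have hK0 : (0 : ℝ) < K := by exact_mod_cast hK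
  have hQV : ‖windowSum T S v t‖ ^ 2 ≤ (∑ k ∈ S, v k) ^ 2 :=
    pow_le_pow_left₀ (norm_nonneg _) (norm_windowSum_le T S hv t) 2
  have hQ : 0 ≤ ‖windowSum T S v t‖ ^ 2 := sq_nonneg _
  have hzeta := mul_le_mul_of_nonneg_left (sq_integral_zeta_le hκ hL t) hK0.le
  have hF := localMoment_nonneg κ t
  have hc := sq_nonneg (Real.sqrt (2 * Real.pi) * Real.exp (1 / 8))
  have hsum := pow_le_pow_left₀ (norm_nonneg _) (norm_smoothSum_le hK0 hn t) 2
  replace hsum := hsum.trans (add_add_sq_le _ _ _)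
  simp only [mul_pow _ (1 + |t|), mul_pow (Real.sqrt K), Real.sq_sqrt hK0.le] at hsum
  rw [mul_pow _ (Real.exp _), mul_pow _ (K : ℝ)] at hsum
  generalize ‖windowSum T S v t‖ ^ 2 = Q at *
  generalize (∑ k ∈ S, v k) ^ 2 = V at *
  generalize (Real.sqrt (2 * Real.pi) * Real.exp (1 / 8)) ^ 2 = c at *
  have hmain := mul_le_mul_of_nonneg_left hQV
    (show 0 ≤ c * K ^ 2 * Real.exp (-t ^ 2 / 2) ^ 2 by positivity)
  have hlocal := mul_le_mul_of_nonneg_left hQV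
    (show 0 ≤ K * L ^ (1 - κ / 2) * localMoment κ t by positivity)
  have herror := mul_le_mul_of_nonneg_left hQV
    (show 0 ≤ smoothSumError K n ^ 2 * (1 + |t|) ^ 2 by positivity)
  have htotal := mul_le_mul_of_nonneg_right hsum hQ
  have hzetaQ := mul_le_mul_of_nonneg_right hzeta hQ
  linarith

theorem integrable_exp_neg_sq_sq (v : NNReal) :
    Integrable (fun t : ℝ => Real.exp (-t ^ 2 / 2) ^ 2) (gaussianReal 0 v) :=
  integrable_of_norm_le_linear (Continuous.aestronglyMeasurable (by fun_prop)) 1 0 fun t => by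
    rw [Real.norm_of_nonneg (by positivity), zero_mul, add_zero]
    exact pow_le_one₀ (Real.exp_nonneg _) (Real.exp_le_one_iff.2 (by nlinarith [sq_nonneg t]))

theorem integrable_windowSum_sq (T : ℝ) (S : Finset ℤ) {v : ℤ → ℝ} (hv : ∀ k, 0 ≤ v k)
    (w : NNReal) : Integrable (fun t => ‖windowSum T S v t‖ ^ 2) (gaussianReal 0 w) := by
  have hmeas := (continuous_windowSum T S v).aestronglyMeasurable (μ := gaussianReal 0 w)
  refine (memLp_two_iff_integrable_sq_norm hmeas).1 ?_
  exact memLp_of_norm_le_linear hmeas (∑ k ∈ S, v k) 0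
    (fun t => by simpa using norm_windowSum_le T S hv t) (by simp)

theorem integrable_one_add_abs_sq (v : NNReal) :
    Integrable (fun t : ℝ => (1 + |t|) ^ 2) (gaussianReal 0 v) :=
  (memLp_of_norm_le_linear (Continuous.aestronglyMeasurable (by fun_prop)) 1 1
    (fun t => by rw [Real.norm_of_nonneg (by positivity), one_mul]) (by simp)).integrable_sq

theorem logForm_le_add_error {κ T L : ℝ} (hκ : 2 ≤ κ) (hT : 0 < T) (hL : 0 < L) {K n : ℕ}
    (hK : 1 ≤ K) (hn : 2 * K ≤ n) (S : Finset ℤ) {v : ℤ → ℝ} (hv : ∀ k, 0 ≤ v k) :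
    logForm T K S v ≤
      12 * ((Real.sqrt (2 * Real.pi) * Real.exp (1 / 8)) ^ 2 * (K ^ 2 * (∑ k ∈ S, v k) ^ 2 / T) +
        (∑' d : ℤ, Real.exp (-(d : ℝ) ^ 2 / 2)) * (K * (L * ∑ k ∈ S, v k ^ 2)) +
        K * (L ^ (1 - κ / 2) * ((∑ k ∈ S, v k) ^ 2 * gaussianMoment κ T)) +
        smoothSumError K n ^ 2 *
          ((∑ k ∈ S, v k) ^ 2 * ∫ t, (1 + |t|) ^ 2 ∂(gaussianReal 0 (T ^ 2).toNNReal))) := by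
  have hκ0 : 0 < κ := by linarith
  refine (logForm_le_integral hT hK hn S hv).trans ?_
  have hmain := integral_exp_neg_sq_gaussianReal_le hT
  have hwindow := integral_windowSum_sq_le hT S v
  have hlocal := integral_localMoment hκ0 T
  have hc := sq_nonneg (Real.sqrt (2 * Real.pi) * Real.exp (1 / 8))
  have hV := sq_nonneg (∑ k ∈ S, v k)
  have hbound := norm_smoothSum_mul_windowSum_sq_le (T := T) hκ hL hK (by omega : 1 ≤ n) S hv
  have hi₁ := integrable_exp_neg_sq_sq (T ^ 2).toNNReal
  have hi₂ := integrable_windowSum_sq T S hv (T ^ 2).toNNReal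
  have hi₃ := integrable_localMoment hκ0 (T ^ 2).toNNReal
  have hi₄ := integrable_one_add_abs_sq (T ^ 2).toNNReal
  generalize gaussianReal 0 (T ^ 2).toNNReal = ν at *
  generalize (Real.sqrt (2 * Real.pi) * Real.exp (1 / 8)) ^ 2 = c at *
  generalize (∑ k ∈ S, v k) ^ 2 = V at *
  replace hi₁ := hi₁.const_mul (3 * (c * K ^ 2 * V))
  replace hi₂ := hi₂.const_mul (3 * (K * L))
  replace hi₃ := hi₃.const_mul (3 * (K * L ^ (1 - κ / 2) * V))
  replace hi₄ := hi₄.const_mul (3 * (smoothSumError K n ^ 2 * V))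
  have hint := integral_mono_of_nonneg (Eventually.of_forall fun t => by positivity)
    (((hi₁.add hi₂).add hi₃).add hi₄) (Eventually.of_forall hbound)
  rw [integral_add' ((hi₁.add hi₂).add hi₃) hi₄, integral_add' (hi₁.add hi₂) hi₃,
    integral_add' hi₁ hi₂] at hint
  simp only [integral_const_mul, hlocal] at hint
  replace hmain := mul_le_mul_of_nonneg_left hmain (show 0 ≤ c * K ^ 2 * V by positivity)
  replace hwindow := mul_le_mul_of_nonneg_left hwindow (show 0 ≤ K * L by positivity)
  have hdiv : c * (K ^ 2 * V / T) = c * K ^ 2 * V * (1 / T) := by ring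
  rw [hdiv]
  linarith

theorem logForm_le {κ T L : ℝ} (hκ : 2 ≤ κ) (hT : 0 < T) (hL : 0 < L) {K : ℕ}
    (hK : 1 ≤ K) (S : Finset ℤ) {v : ℤ → ℝ} (hv : ∀ k, 0 ≤ v k) :
    logForm T K S v ≤
      12 * ((Real.sqrt (2 * Real.pi) * Real.exp (1 / 8)) ^ 2 * (K ^ 2 * (∑ k ∈ S, v k) ^ 2 / T) +
        (∑' d : ℤ, Real.exp (-(d : ℝ) ^ 2 / 2)) * (K * (L * ∑ k ∈ S, v k ^ 2)) +
        K * (L ^ (1 - κ / 2) * ((∑ k ∈ S, v k) ^ 2 * gaussianMoment κ T))) := by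
  refine ge_of_tendsto ?_ ((eventually_ge_atTop (2 * K)).mono fun n hn =>
    logForm_le_add_error hκ hT hL hK hn S hv)
  simpa using ((((tendsto_smoothSumError K).pow 2).mul_const _).const_add _).const_mul (12 : ℝ)

theorem exists_logForm_le : ∃ C : ℝ, 0 < C ∧ ∀ (κ T L : ℝ) (K : ℕ) (S : Finset ℤ) (v : ℤ → ℝ),
    2 ≤ κ → 0 < T → 0 < L → 1 ≤ K → (∀ k, 0 ≤ v k) →
    logForm T K S v ≤ C * ((K : ℝ) ^ 2 * (∑ k ∈ S, v k) ^ 2 / T + K * (L * ∑ k ∈ S, v k ^ 2) +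
      K * (L ^ (1 - κ / 2) * ((∑ k ∈ S, v k) ^ 2 * gaussianMoment κ T))) := by
  set c := (Real.sqrt (2 * Real.pi) * Real.exp (1 / 8)) ^ 2 with hc
  set g := ∑' d : ℤ, Real.exp (-(d : ℝ) ^ 2 / 2) with hg
  have hc0 : 0 ≤ c := sq_nonneg _
  have hg0 : 0 ≤ g := tsum_nonneg fun d => Real.exp_nonneg _
  refine ⟨12 * (c + g + 1), by positivity, fun κ T L K S v hκ hT hL hK hv => ?_⟩
  refine (logForm_le hκ hT hL hK S hv).trans ?_
  rw [← hc, ← hg, mul_assoc]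
  refine mul_le_mul_of_nonneg_left ?_ (by norm_num)
  have hM := gaussianMoment_nonneg κ T
  have hmain : 0 ≤ (K : ℝ) ^ 2 * (∑ k ∈ S, v k) ^ 2 / T := by positivity
  have hdiag : 0 ≤ K * (L * ∑ k ∈ S, v k ^ 2) := by positivity
  have hzeta : 0 ≤ K * (L ^ (1 - κ / 2) * ((∑ k ∈ S, v k) ^ 2 * gaussianMoment κ T)) := by
    positivity
  nlinarith [mul_nonneg hc0 hdiag, mul_nonneg hc0 hzeta, mul_nonneg hg0 hmain,
    mul_nonneg hg0 hzeta]

/-! ### Gaussian moments of `ζ` -/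

theorem norm_zeta_critPt_abs (u : ℝ) : ‖riemannZeta (critPt |u|)‖ = ‖riemannZeta (critPt u)‖ := by
  rcases abs_cases u with ⟨h, _⟩ | ⟨h, _⟩
  · rw [h]
  · have : critPt (-u) = (starRingEnd ℂ) (critPt u) := by
      apply Complex.ext <;> simp
    rw [h, this, riemannZeta_conj, Complex.norm_conj]

theorem summable_exp_neg_sq_mul_rpow (p : ℝ) :
    Summable fun n : ℕ => Real.exp (-(n : ℝ) ^ 2 / 4) * ((n : ℝ) + 1) ^ p := by
  obtain ⟨k, hk⟩ := exists_nat_ge p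
  have h := ((summable_nat_add_iff 1).2
    (Real.summable_pow_mul_exp_neg_nat_mul k (show (0 : ℝ) < 1 / 2 by norm_num))).mul_left
      (Real.exp (3 / 4))
  refine h.of_nonneg_of_le (fun n => by positivity) fun n => ?_
  have h1 : ((n : ℝ) + 1) ^ p ≤ ((n + 1 : ℕ) : ℝ) ^ k := by
    rw [← Real.rpow_natCast]
    push_cast
    exact Real.rpow_le_rpow_of_exponent_le (by linarith [(Nat.cast_nonneg n : (0 : ℝ) ≤ n)]) hk
  have h2 : Real.exp (-(n : ℝ) ^ 2 / 4) ≤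
      Real.exp (3 / 4) * Real.exp (-(1 / 2) * ((n + 1 : ℕ) : ℝ)) := by
    rw [← Real.exp_add, Real.exp_le_exp]
    push_cast
    nlinarith [sq_nonneg ((n : ℝ) - 1)]
  calc _ ≤ (Real.exp (3 / 4) * Real.exp (-(1 / 2) * ((n + 1 : ℕ) : ℝ))) *
        ((n + 1 : ℕ) : ℝ) ^ k := by gcongr
    _ = _ := by ring

theorem gaussianMoment_eq (κ T : ℝ) : gaussianMoment κ T =
    2 * ∫ u in Set.Ioi (0 : ℝ), gaussianPDFReal 0 ((T ^ 2).toNNReal + 1) u *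
      ‖riemannZeta (critPt u)‖ ^ κ := by
  rw [gaussianMoment, integral_gaussianReal_eq_integral_smul (by simp), ← integral_comp_abs
    (f := fun u => gaussianPDFReal 0 ((T ^ 2).toNNReal + 1) u * ‖riemannZeta (critPt u)‖ ^ κ)]
  refine integral_congr_ae (Eventually.of_forall fun u => ?_)
  simp only [norm_zeta_critPt_abs, smul_eq_mul]
  congr 1
  simp [gaussianPDFReal]

theorem gaussianPDFReal_window_le {T u : ℝ} {n : ℕ} (hT : 1 ≤ T) (hu : n * T ≤ u) :
    gaussianPDFReal 0 ((T ^ 2).toNNReal + 1) u ≤ 1 / T * Real.exp (-(n : ℝ) ^ 2 / 4) := by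
  have hT0 : 0 < T := by linarith
  rw [gaussianPDFReal, NNReal.coe_add, Real.coe_toNNReal _ (sq_nonneg T), NNReal.coe_one, sub_zero]
  have hT2 : T ^ 2 + 1 ≤ 2 * T ^ 2 := by nlinarith
  refine mul_le_mul ?_ ?_ (Real.exp_nonneg _) (by positivity)
  · rw [one_div]
    refine inv_anti₀ hT0 ?_
    refine Real.le_sqrt_of_sq_le ?_
    nlinarith [Real.pi_gt_three, sq_nonneg T]
  · rw [Real.exp_le_exp, neg_div, neg_div, neg_le_neg_iff, div_le_div_iff₀ (by norm_num)
      (by positivity)]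
    have h1 : ((n : ℝ) * T) ^ 2 ≤ u ^ 2 := pow_le_pow_left₀ (by positivity) hu 2
    nlinarith [mul_nonneg (sq_nonneg (n : ℝ)) (sub_nonneg.2 hT2)]

theorem integrable_gaussianPDFReal_mul {f : ℝ → ℝ} {μ : ℝ} {v : NNReal} (hv : v ≠ 0)
    (hf : Integrable f (gaussianReal μ v)) : Integrable fun u => gaussianPDFReal μ v u * f u := by
  rw [gaussianReal_of_var_ne_zero _ hv, integrable_withDensity_iff_integrable_smul'
    (measurable_gaussianPDF _ _) (Eventually.of_forall fun x => gaussianPDF_lt_top)] at hf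
  simpa only [toReal_gaussianPDF, smul_eq_mul] using hf

section GaussianWindow

variable {Z : ℝ → ℝ} {C T q : ℝ}

theorem integral_gaussianPDFReal_window_le (hZ : Continuous Z) (hZ0 : ∀ u, 0 ≤ Z u) (hT : 1 ≤ T)
    (hmoment : ∀ X, T ≤ X → ∫ u in (0 : ℝ)..X, Z u ≤ C * X ^ (1 + q)) (n : ℕ) :
    ∫ u in (n * T)..((n + 1 : ℕ) * T), gaussianPDFReal 0 ((T ^ 2).toNNReal + 1) u * Z u ≤
      C * T ^ q * (Real.exp (-(n : ℝ) ^ 2 / 4) * ((n : ℝ) + 1) ^ (1 + q)) := by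
  have hT0 : 0 < T := one_pos.trans_le hT
  have hle : (n : ℝ) * T ≤ (n + 1 : ℕ) * T := by push_cast; nlinarith
  have hpdf : Continuous (gaussianPDFReal 0 ((T ^ 2).toNNReal + 1)) := by
    unfold gaussianPDFReal
    fun_prop
  have htail : ∫ u in (n * T)..((n + 1 : ℕ) * T), Z u ≤ ∫ u in (0 : ℝ)..((n + 1 : ℕ) * T), Z u := by
    rw [← intervalIntegral.integral_add_adjacent_intervals (hZ.intervalIntegrable 0 (n * T))
      (hZ.intervalIntegrable _ _)]
    exact le_add_of_nonneg_left
      (intervalIntegral.integral_nonneg (by positivity) fun u _ => hZ0 u)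
  calc ∫ u in (n * T)..((n + 1 : ℕ) * T), gaussianPDFReal 0 ((T ^ 2).toNNReal + 1) u * Z u
      ≤ ∫ u in (n * T)..((n + 1 : ℕ) * T), 1 / T * Real.exp (-(n : ℝ) ^ 2 / 4) * Z u :=
        intervalIntegral.integral_mono_on hle ((hpdf.mul hZ).intervalIntegrable _ _)
          ((hZ.const_mul _).intervalIntegrable _ _) fun u hu =>
            mul_le_mul_of_nonneg_right (gaussianPDFReal_window_le hT hu.1) (hZ0 u)
    _ = 1 / T * Real.exp (-(n : ℝ) ^ 2 / 4) * ∫ u in (n * T)..((n + 1 : ℕ) * T), Z u :=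
        intervalIntegral.integral_const_mul _ _
    _ ≤ 1 / T * Real.exp (-(n : ℝ) ^ 2 / 4) * (C * ((n + 1 : ℕ) * T) ^ (1 + q)) :=
        mul_le_mul_of_nonneg_left
          (htail.trans (hmoment _ (by push_cast; nlinarith))) (by positivity)
    _ = C * T ^ q * (Real.exp (-(n : ℝ) ^ 2 / 4) * ((n : ℝ) + 1) ^ (1 + q)) := by
        push_cast
        rw [Real.mul_rpow (by positivity) hT0.le, Real.rpow_add hT0 1, Real.rpow_one]
        field_simp

theorem setIntegral_Ioi_gaussianPDFReal_mul_le (hZ : Continuous Z) (hZ0 : ∀ u, 0 ≤ Z u)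
    (hZi : Integrable Z (gaussianReal 0 ((T ^ 2).toNNReal + 1))) (hC : 0 ≤ C) (hT : 1 ≤ T)
    (hmoment : ∀ X, T ≤ X → ∫ u in (0 : ℝ)..X, Z u ≤ C * X ^ (1 + q)) :
    ∫ u in Set.Ioi (0 : ℝ), gaussianPDFReal 0 ((T ^ 2).toNNReal + 1) u * Z u ≤
      C * T ^ q * ∑' n : ℕ, Real.exp (-(n : ℝ) ^ 2 / 4) * ((n : ℝ) + 1) ^ (1 + q) := by
  have hT0 : 0 < T := one_pos.trans_le hT
  have hint := integrable_gaussianPDFReal_mul (by simp) hZi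
  refine le_of_tendsto (intervalIntegral_tendsto_integral_Ioi 0 hint.integrableOn
    (tendsto_natCast_atTop_atTop.atTop_mul_const hT0)) (Eventually.of_forall fun N => ?_)
  have hsplit := intervalIntegral.sum_integral_adjacent_intervals (μ := volume)
    (a := fun n : ℕ => (n : ℝ) * T) (n := N) fun k _ => hint.intervalIntegrable
  simp only [Nat.cast_zero, zero_mul] at hsplit
  rw [← hsplit]
  refine (Finset.sum_le_sum fun n _ =>
    integral_gaussianPDFReal_window_le hZ hZ0 hT hmoment n).trans ?_
  rw [← Finset.mul_sum]
  exact mul_le_mul_of_nonneg_left ((summable_exp_neg_sq_mul_rpow _).sum_le_tsum _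
    fun n _ => by positivity) (by positivity)

end GaussianWindow

theorem ZetaMomentBound.exists_integral_le {κ m : ℝ} (h : ZetaMomentBound κ m) {ε : ℝ}
    (hε : 0 < ε) : ∃ C T₀ : ℝ, 0 < C ∧ 1 ≤ T₀ ∧ ∀ X, T₀ ≤ X →
      ∫ u in (0 : ℝ)..X, ‖riemannZeta (critPt u)‖ ^ κ ≤ C * X ^ (1 + (m + ε)) := by
  obtain ⟨C, hC, hbig⟩ := (h ε hε).exists_pos
  obtain ⟨T₁, hT₁⟩ := eventually_atTop.1 hbig.bound
  refine ⟨C, max T₁ 1, hC, le_max_right _ _, fun X hX => ?_⟩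
  have hX0 : 0 < X := one_pos.trans_le ((le_max_right _ _).trans hX)
  have hmean := hT₁ X ((le_max_left _ _).trans hX)
  rw [Real.norm_of_nonneg (Real.rpow_nonneg hX0.le _)] at hmean
  replace hmean := (le_abs_self _).trans hmean
  change 1 / X * ∫ u in (0 : ℝ)..X, ‖riemannZeta (critPt u)‖ ^ κ ≤ _ at hmean
  rw [one_div, inv_mul_le_iff₀ hX0] at hmean
  rwa [Real.rpow_add hX0, Real.rpow_one, mul_left_comm]

theorem ZetaMomentBound.exists_gaussianMoment_le {κ m : ℝ} (hκ : 0 < κ) (h : ZetaMomentBound κ m)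
    {ε : ℝ} (hε : 0 < ε) :
    ∃ C T₀ : ℝ, 0 < C ∧ 1 ≤ T₀ ∧ ∀ T, T₀ ≤ T → gaussianMoment κ T ≤ C * T ^ (m + ε) := by
  obtain ⟨C, T₀, hC, hT₀, hmoment⟩ := h.exists_integral_le hε
  set A := ∑' n : ℕ, Real.exp (-(n : ℝ) ^ 2 / 4) * ((n : ℝ) + 1) ^ (1 + (m + ε))
  refine ⟨2 * (C * A) + 1, T₀, by positivity, hT₀, fun T hT => ?_⟩
  have hT0 : 0 < T := one_pos.trans_le (hT₀.trans hT)
  have hcont : Continuous fun u => ‖riemannZeta (critPt u)‖ ^ κ :=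
    continuous_zeta_critPt.norm.rpow_const fun _ => Or.inr hκ.le
  have hint := integrable_zeta_add_rpow_gaussianReal hκ 0 ((T ^ 2).toNNReal + 1)
  simp only [zero_add] at hint
  have hhalf := setIntegral_Ioi_gaussianPDFReal_mul_le hcont
    (fun u => Real.rpow_nonneg (norm_nonneg _) κ) hint hC.le (hT₀.trans hT)
    fun X hX => hmoment X (hT.trans hX)
  have hpow : 0 ≤ T ^ (m + ε) := Real.rpow_nonneg hT0.le _
  rw [gaussianMoment_eq]
  linarith

theorem ZetaMomentBound.nonneg {κ m : ℝ} (hκ : 2 ≤ κ) (h : ZetaMomentBound κ m) : 0 ≤ m := by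
  by_contra! hm
  obtain ⟨C, T₀, -, hT₀, hmoment⟩ :=
    h.exists_gaussianMoment_le (by linarith) (show 0 < -(m / 2) by linarith)
  obtain ⟨D, hD, hform⟩ := exists_logForm_le
  set L := 1 / (4 * D) with hL
  have hL0 : 0 < L := by positivity
  have hsmall : ∀ᶠ T : ℝ in atTop,
      D * (1 / T + L + L ^ (1 - κ / 2) * (C * T ^ (m + -(m / 2)))) < 1 := by
    have hpow : Tendsto (fun T : ℝ => T ^ (m + -(m / 2))) atTop (𝓝 0) := by
      simpa [show -(-(m / 2)) = m + -(m / 2) by ring]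
        using tendsto_rpow_neg_atTop (y := -(m / 2)) (by linarith)
    have hinv : Tendsto (fun T : ℝ => 1 / T) atTop (𝓝 0) := by
      simpa using tendsto_inv_atTop_zero (𝕜 := ℝ)
    refine Tendsto.eventually_lt_const ?_ (((hinv.add_const L).add
      ((hpow.const_mul C).const_mul (L ^ (1 - κ / 2)))).const_mul D)
    rw [mul_zero, mul_zero, add_zero, zero_add, hL]
    field_simp
    norm_num
  obtain ⟨T, hT, hT₀T⟩ := (hsmall.and (eventually_ge_atTop T₀)).exists
  have hone : 1 ≤ D * (1 / T + L + L ^ (1 - κ / 2) * gaussianMoment κ T) := by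
    simpa [logForm] using hform κ T L 1 {0} (fun _ => 1) hκ (by linarith) hL0 le_rfl
      fun _ => zero_le_one
  have hzeta : L ^ (1 - κ / 2) * gaussianMoment κ T ≤ L ^ (1 - κ / 2) * (C * T ^ (m + -(m / 2))) :=
    mul_le_mul_of_nonneg_left (hmoment T hT₀T) (by positivity)
  have htotal := mul_le_mul_of_nonneg_left (add_le_add_right hzeta (1 / T + L)) hD.le
  linarith

/-! ### Counting close dilates -/

section Counting

variable {ι : Type*}

theorem card_filter_eq_sum_mul {ι' γ : Type*} [DecidableEq γ] (A : Finset ι) (B : Finset ι')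
    (f : ι → γ) (g : ι' → γ) {U : Finset γ}
    (hU : ∀ p ∈ A, f p ∈ U) :
    ((A ×ˢ B).filter fun r => f r.1 = g r.2).card =
      ∑ n ∈ U, (A.filter fun p => f p = n).card * (B.filter fun q => g q = n).card := by
  rw [Finset.card_eq_sum_card_fiberwise (f := fun r : ι × ι' => f r.1) (t := U)]
  · refine Finset.sum_congr rfl fun n _ => ?_
    rw [← Finset.card_product]
    congr 1
    ext ⟨p, q⟩
    simp only [Finset.mem_filter, Finset.mem_product]
    constructor
    · rintro ⟨⟨⟨h1, h2⟩, h3⟩, h4⟩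
      exact ⟨⟨h1, h4⟩, h2, h3 ▸ h4⟩
    · rintro ⟨⟨h1, h4⟩, h2, h5⟩
      exact ⟨⟨⟨h1, h2⟩, h4.trans h5.symm⟩, h4⟩
  · intro r hr
    simp only [Finset.coe_filter, Finset.mem_product, Set.mem_ofPred_eq] at hr
    exact hU _ hr.1.1

theorem card_filter_eq_le_sqrt {ι' γ : Type*} [DecidableEq γ] (A : Finset ι) (B : Finset ι')
    (f : ι → γ) (g : ι' → γ) :
    (((A ×ˢ B).filter fun r => f r.1 = g r.2).card : ℝ) ≤
      Real.sqrt ((A ×ˢ A).filter fun r => f r.1 = f r.2).card *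
        Real.sqrt ((B ×ˢ B).filter fun r => g r.1 = g r.2).card := by
  set U := A.image f ∪ B.image g
  have hA : ∀ p ∈ A, f p ∈ U := fun p hp =>
    Finset.mem_union_left _ (Finset.mem_image_of_mem f hp)
  have hB : ∀ p ∈ B, g p ∈ U := fun p hp =>
    Finset.mem_union_right _ (Finset.mem_image_of_mem g hp)
  rw [card_filter_eq_sum_mul A B f g hA, card_filter_eq_sum_mul A A f f hA,
    card_filter_eq_sum_mul B B g g hB, ← Real.sqrt_mul (Nat.cast_nonneg _)]
  refine Real.le_sqrt_of_sq_le ?_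
  push_cast
  simp_rw [← pow_two]
  exact Finset.sum_mul_sq_le_sq_mul_sq U _ _

theorem card_filter_abs_sub_le {ι' : Type*} (A : Finset ι) (B : Finset ι') (f : ι → ℤ)
    (g : ι' → ℤ) (D : ℕ) :
    (((A ×ˢ B).filter fun r => |f r.1 - g r.2| ≤ D).card : ℝ) ≤ (2 * D + 1) *
      (Real.sqrt ((A ×ˢ A).filter fun r => f r.1 = f r.2).card *
        Real.sqrt ((B ×ˢ B).filter fun r => g r.1 = g r.2).card) := by
  classical
  have hsub : ((A ×ˢ B).filter fun r => |f r.1 - g r.2| ≤ D) ⊆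
      (Finset.Icc (-(D : ℤ)) D).biUnion fun d => (A ×ˢ B).filter fun r => f r.1 = g r.2 + d := by
    intro r hr
    rw [Finset.mem_filter, abs_le] at hr
    refine Finset.mem_biUnion.2 ⟨f r.1 - g r.2, Finset.mem_Icc.2 hr.2, ?_⟩
    exact Finset.mem_filter.2 ⟨hr.1, by ring⟩
  have hshift : ∀ d ∈ Finset.Icc (-(D : ℤ)) D,
      (((A ×ˢ B).filter fun r => f r.1 = g r.2 + d).card : ℝ) ≤
      Real.sqrt ((A ×ˢ A).filter fun r => f r.1 = f r.2).card *
        Real.sqrt ((B ×ˢ B).filter fun r => g r.1 = g r.2).card := fun d _ => by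
    simpa using card_filter_eq_le_sqrt A B f (fun q => g q + d)
  have hcard : (((A ×ˢ B).filter fun r => |f r.1 - g r.2| ≤ D).card : ℝ) ≤
      ∑ d ∈ Finset.Icc (-(D : ℤ)) D, (((A ×ˢ B).filter fun r => f r.1 = g r.2 + d).card : ℝ) :=
    mod_cast (Finset.card_le_card hsub).trans Finset.card_biUnion_le
  refine (hcard.trans (Finset.sum_le_card_nsmul _ _ _ hshift)).trans_eq ?_
  rw [nsmul_eq_mul, Int.card_Icc, show ((D : ℤ) + 1 - -(D : ℤ)).toNat = 2 * D + 1 by omega]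
  push_cast
  rfl

/-- The number of ordered pairs of indices in `P` whose `z`-values are at distance less than `1`. -/
noncomputable def closePairs (P : Finset ι) (z : ι → ℝ) : ℕ :=
  ((P ×ˢ P).filter fun r => |z r.1 - z r.2| < 1).card

theorem card_filter_floor_eq_le_closePairs (A : Finset ι) (z : ι → ℝ) {a : ℝ} (ha : 1 ≤ a) :
    ((A ×ˢ A).filter fun r => ⌊a * z r.1⌋ = ⌊a * z r.2⌋).card ≤ closePairs A z := by
  refine Finset.card_le_card (Finset.monotone_filter_right _ fun r _ hr => ?_)
  have hlt := Int.abs_sub_lt_one_of_floor_eq_floor hr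
  rw [← mul_sub, abs_mul, abs_of_pos (by linarith)] at hlt
  exact (le_mul_of_one_le_left (abs_nonneg _) ha).trans_lt hlt

theorem abs_floor_sub_floor_le {x y : ℝ} {D : ℕ} (h : |x - y| ≤ D) : |⌊x⌋ - ⌊y⌋| ≤ (D + 1 : ℕ) := by
  rw [abs_le] at h
  have hx := Int.floor_le x
  have hx' := Int.lt_floor_add_one x
  have hy := Int.floor_le y
  have hy' := Int.lt_floor_add_one y
  have hlt : |((⌊x⌋ - ⌊y⌋ : ℤ) : ℝ)| < ((D + 1 : ℕ) : ℝ) := by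
    push_cast
    rw [abs_lt]
    constructor <;> linarith
  exact_mod_cast hlt.le

/-- The pairs `(p, q) ∈ A × B` for which the dilates `j * z p` and `l * z q` are at distance at
most `H`. -/
noncomputable def closeDilates (A B : Finset ι) (z : ι → ℝ) (j l : ℕ) (H : ℝ) : Finset (ι × ι) :=
  (A ×ˢ B).filter fun r => |j * z r.1 - l * z r.2| ≤ H

/-- The number of quadruples `(j, l, p, q)`, with multipliers `j, l ∈ [K, 2K)` and `p, q ∈ P`, for
which the dilates `j * z p` and `l * z q` are at distance at most `H`. -/
noncomputable def dilateEnergy (P : Finset ι) (z : ι → ℝ) (K : ℕ) (H : ℝ) : ℕ :=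
  ∑ j ∈ Finset.Ico K (2 * K), ∑ l ∈ Finset.Ico K (2 * K), (closeDilates P P z j l H).card

theorem card_closeDilates_le (A B : Finset ι) (z : ι → ℝ) {K j l H : ℕ}
    (hj : j ∈ Finset.Ico K (2 * K)) (hl : l ∈ Finset.Ico K (2 * K)) (hH : 1 ≤ H) :
    ((closeDilates A B z j l H).card : ℝ) ≤
      9 * H * (Real.sqrt (closePairs A z) * Real.sqrt (closePairs B z)) := by
  rw [Finset.mem_Ico] at hj hl
  have hj1 : (1 : ℝ) ≤ j := by exact_mod_cast (by omega : 1 ≤ j)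
  have hjl : (j : ℝ) ≤ 2 * l := by exact_mod_cast (by omega : j ≤ 2 * l)
  have hj0 : (0 : ℝ) < j := by linarith
  have hratio : 1 ≤ 2 * l / (j : ℝ) := (one_le_div hj0).2 hjl
  set f : ι → ℤ := fun p => ⌊2 * z p⌋
  set g : ι → ℤ := fun q => ⌊2 * l / (j : ℝ) * z q⌋
  have hfloor : ∀ r ∈ closeDilates A B z j l H, |f r.1 - g r.2| ≤ (2 * H + 1 : ℕ) := fun r hr => by
    have hscale : 2 * z r.1 - 2 * l / (j : ℝ) * z r.2 = 2 / j * (j * z r.1 - l * z r.2) := by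
      field_simp
    refine abs_floor_sub_floor_le (D := 2 * H) ?_
    rw [hscale, abs_mul, abs_of_pos (by positivity), Nat.cast_mul, Nat.cast_two]
    exact mul_le_mul ((div_le_iff₀ hj0).2 (by linarith)) (Finset.mem_filter.1 hr).2
      (abs_nonneg _) zero_le_two
  have hsub : closeDilates A B z j l H ⊆
      (A ×ˢ B).filter fun r => |f r.1 - g r.2| ≤ (2 * H + 1 : ℕ) := fun r hr =>
    Finset.mem_filter.2 ⟨(Finset.mem_filter.1 hr).1, hfloor r hr⟩
  have hcard := card_filter_abs_sub_le A B f g (2 * H + 1)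
  refine (Nat.cast_le.2 (Finset.card_le_card hsub)).trans (hcard.trans ?_)
  have hH' : (1 : ℝ) ≤ H := by exact_mod_cast hH
  refine mul_le_mul (by push_cast; linarith) (mul_le_mul ?_ ?_ (Real.sqrt_nonneg _)
    (Real.sqrt_nonneg _)) (by positivity) (by positivity)
  · exact Real.sqrt_le_sqrt (Nat.cast_le.2 (card_filter_floor_eq_le_closePairs A z one_le_two))
  · exact Real.sqrt_le_sqrt (Nat.cast_le.2 (card_filter_floor_eq_le_closePairs B z hratio))

theorem mul_log_sub_log_le_one {T H b c d : ℝ} (hT : 0 < T) (hb : 0 < b) (hTH : T * H ≤ b)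
    (hc : b ≤ c) (hd : b ≤ d) (hcd : c - d ≤ H) : T * (Real.log c - Real.log d) ≤ 1 := by
  have hc0 : 0 < c := hb.trans_le hc
  have hd0 : 0 < d := hb.trans_le hd
  have hlog : Real.log c - Real.log d ≤ (c - d) / d := by
    rw [← Real.log_div hc0.ne' hd0.ne', sub_div, div_self hd0.ne']
    exact Real.log_le_sub_one_of_pos (div_pos hc0 hd0)
  refine (mul_le_mul_of_nonneg_left hlog hT.le).trans ?_
  rw [← mul_div_assoc, div_le_one hd0]
  exact (mul_le_mul_of_nonneg_left hcd hT.le).trans (hTH.trans hd)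

theorem abs_log_window_sub_le {T B H x y : ℝ} {K j l : ℕ} (hT : 0 < T) (hB : 0 < B) (hK : 1 ≤ K)
    (hTB : T * H ≤ K * B) (hj : K ≤ j) (hl : K ≤ l) (hx : B ≤ x) (hy : B ≤ y)
    (h : |j * x - l * y| ≤ H) :
    |T * (Real.log j - Real.log l) + (⌊T * Real.log x⌋ - ⌊T * Real.log y⌋)| ≤ 2 := by
  have hK0 : (0 : ℝ) < K := by exact_mod_cast hK
  have hjK : (K : ℝ) ≤ j := by exact_mod_cast hj
  have hlK : (K : ℝ) ≤ l := by exact_mod_cast hl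
  have hj0 := hK0.trans_le hjK
  have hl0 := hK0.trans_le hlK
  have hjx : K * B ≤ j * x := mul_le_mul hjK hx hB.le hj0.le
  have hly : K * B ≤ l * y := mul_le_mul hlK hy hB.le hl0.le
  have hKB : 0 < K * B := mul_pos hK0 hB
  rw [abs_le] at h
  have hupper := mul_log_sub_log_le_one hT hKB hTB hjx hly h.2
  have hlower := mul_log_sub_log_le_one hT hKB hTB hly hjx (by linarith [h.1])
  rw [Real.log_mul hj0.ne' (hB.trans_le hx).ne', Real.log_mul hl0.ne' (hB.trans_le hy).ne']
    at hupper hlower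
  have hx₁ := Int.floor_le (T * Real.log x)
  have hx₂ := Int.lt_floor_add_one (T * Real.log x)
  have hy₁ := Int.floor_le (T * Real.log y)
  have hy₂ := Int.lt_floor_add_one (T * Real.log y)
  rw [abs_le]
  constructor <;> linarith

/-- The logarithmic window of the indices `p ∈ P` with `k / T ≤ log (z p) < (k + 1) / T`. -/
noncomputable def logWindow (P : Finset ι) (z : ι → ℝ) (T : ℝ) (k : ℤ) : Finset ι :=
  P.filter fun p => ⌊T * Real.log (z p)⌋ = k

/-- The square root of the number of close pairs within a logarithmic window. -/
noncomputable def windowWeight (P : Finset ι) (z : ι → ℝ) (T : ℝ) (k : ℤ) : ℝ :=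
  Real.sqrt (closePairs (logWindow P z T k) z)

/-- The indices of the nonempty logarithmic windows. -/
noncomputable def windowSet (P : Finset ι) (z : ι → ℝ) (T : ℝ) : Finset ℤ :=
  P.image fun p => ⌊T * Real.log (z p)⌋

variable (P : Finset ι) (z : ι → ℝ) (T : ℝ)

theorem windowWeight_nonneg (k : ℤ) : 0 ≤ windowWeight P z T k := Real.sqrt_nonneg _

theorem windowWeight_le_card (k : ℤ) : windowWeight P z T k ≤ (logWindow P z T k).card := by
  refine Real.sqrt_le_iff.2 ⟨Nat.cast_nonneg _, ?_⟩
  have hcard : closePairs (logWindow P z T k) z ≤ (logWindow P z T k).card ^ 2 := by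
    rw [pow_two, ← Finset.card_product]
    exact Finset.card_filter_le _ _
  exact_mod_cast hcard

theorem sum_windowWeight_le : ∑ k ∈ windowSet P z T, windowWeight P z T k ≤ P.card := by
  refine (Finset.sum_le_sum fun k _ => windowWeight_le_card P z T k).trans_eq ?_
  rw [← Nat.cast_sum]
  exact congrArg Nat.cast (Finset.card_eq_sum_card_fiberwise
    fun p hp => Finset.mem_image_of_mem _ hp).symm

theorem sum_windowWeight_sq_le :
    ∑ k ∈ windowSet P z T, windowWeight P z T k ^ 2 ≤ closePairs P z := by
  classical
  simp_rw [windowWeight, Real.sq_sqrt (Nat.cast_nonneg _), ← Nat.cast_sum, closePairs]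
  rw [← Finset.card_biUnion]
  · refine Nat.cast_le.2 (Finset.card_le_card fun r hr => ?_)
    simp only [Finset.mem_biUnion, Finset.mem_filter, Finset.mem_product, logWindow] at hr ⊢
    obtain ⟨k, -, ⟨⟨h₁, -⟩, h₂, -⟩, hclose⟩ := hr
    exact ⟨⟨h₁, h₂⟩, hclose⟩
  · refine fun k _ k' _ hkk => Finset.disjoint_left.2 fun r hr hr' => hkk ?_
    simp only [Finset.mem_filter, Finset.mem_product, logWindow] at hr hr'
    exact hr.1.1.2.symm.trans hr'.1.1.2

theorem card_closeDilates_le_sum_windows (j l : ℕ) (H : ℝ) :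
    ((closeDilates P P z j l H).card : ℝ) ≤ ∑ k ∈ windowSet P z T, ∑ k' ∈ windowSet P z T,
      ((closeDilates (logWindow P z T k) (logWindow P z T k') z j l H).card : ℝ) := by
  classical
  rw [← Finset.sum_product']
  have hsub : closeDilates P P z j l H ⊆ (windowSet P z T ×ˢ windowSet P z T).biUnion fun k =>
      closeDilates (logWindow P z T k.1) (logWindow P z T k.2) z j l H := by
    intro r hr
    simp only [closeDilates, logWindow, Finset.mem_biUnion, Finset.mem_filter,
      Finset.mem_product] at hr ⊢
    exact ⟨(⌊T * Real.log (z r.1)⌋, ⌊T * Real.log (z r.2)⌋),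
      ⟨Finset.mem_image_of_mem _ hr.1.1, Finset.mem_image_of_mem _ hr.1.2⟩,
      ⟨⟨hr.1.1, rfl⟩, hr.1.2, rfl⟩, hr.2⟩
  exact_mod_cast (Finset.card_le_card hsub).trans Finset.card_biUnion_le

variable {P z T} {B : ℝ} {K H : ℕ}

theorem card_closeDilates_logWindow_le (hT : 0 < T) (hB : 0 < B) (hK : 1 ≤ K) (hH : 1 ≤ H)
    (hTB : T * H ≤ K * B) (hz : ∀ p ∈ P, B ≤ z p) {j l : ℕ} (hj : j ∈ Finset.Ico K (2 * K))
    (hl : l ∈ Finset.Ico K (2 * K)) (k k' : ℤ) :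
    ((closeDilates (logWindow P z T k) (logWindow P z T k') z j l H).card : ℝ) ≤
      9 * H * Real.exp 2 * (windowWeight P z T k * windowWeight P z T k' *
        Real.exp (-(T * (Real.log j - Real.log l) + (k - k')) ^ 2 / 2)) := by
  have hweight := mul_nonneg (windowWeight_nonneg P z T k) (windowWeight_nonneg P z T k')
  rcases Finset.eq_empty_or_nonempty
    (closeDilates (logWindow P z T k) (logWindow P z T k') z j l H) with hempty | ⟨r, hr⟩
  · rw [hempty, Finset.card_empty, Nat.cast_zero]
    positivity
  · simp only [closeDilates, logWindow, Finset.mem_filter, Finset.mem_product] at hr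
    obtain ⟨⟨⟨h₁, rfl⟩, h₂, rfl⟩, hclose⟩ := hr
    have hwindow := abs_log_window_sub_le hT hB hK hTB (Finset.mem_Ico.1 hj).1
      (Finset.mem_Ico.1 hl).1 (hz _ h₁) (hz _ h₂) hclose
    refine (card_closeDilates_le _ _ z hj hl hH).trans ?_
    rw [mul_assoc (9 * (H : ℝ)), mul_left_comm (Real.exp 2), ← Real.exp_add]
    refine mul_le_mul_of_nonneg_left (le_mul_of_one_le_right hweight (Real.one_le_exp ?_))
      (by positivity)
    linarith [sq_le_sq' (abs_le.1 hwindow).1 (abs_le.1 hwindow).2]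

theorem dilateEnergy_le_logForm (hT : 0 < T) (hB : 0 < B) (hK : 1 ≤ K) (hH : 1 ≤ H)
    (hTB : T * H ≤ K * B) (hz : ∀ p ∈ P, B ≤ z p) :
    (dilateEnergy P z K H : ℝ) ≤
      9 * H * Real.exp 2 * logForm T K (windowSet P z T) (windowWeight P z T) := by
  simp only [dilateEnergy, Nat.cast_sum]
  refine (Finset.sum_le_sum fun j hj => Finset.sum_le_sum fun l hl =>
    (card_closeDilates_le_sum_windows P z T j l H).trans (Finset.sum_le_sum fun k _ =>
      Finset.sum_le_sum fun k' _ =>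
        card_closeDilates_logWindow_le hT hB hK hH hTB hz hj hl k k')).trans_eq ?_
  simp_rw [← Finset.mul_sum]
  congr 1
  rw [logForm, Finset.sum_product]
  refine Finset.sum_congr rfl fun j _ => ?_
  rw [Finset.sum_comm]
  exact Finset.sum_congr rfl fun k _ => by rw [Finset.sum_product]

end Counting

/-! ### Detection of small gaps -/

section CosineKernel

theorem norm_sq_exp_sum_eq_sum_cos {ι : Type*} (s : Finset ι) (a θ : ι → ℝ) :
    ‖∑ i ∈ s, (a i : ℂ) * Complex.exp (θ i * Complex.I)‖ ^ 2 =
      ∑ i ∈ s, ∑ j ∈ s, a i * a j * Real.cos (θ i - θ j) := by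
  have h := congrArg Complex.re (norm_sq_exp_sum s a θ (-1))
  simp only [Complex.re_sum, Complex.ofReal_re, ← Complex.ofReal_neg, neg_one_mul, neg_neg] at h
  rw [h]
  refine Finset.sum_congr rfl fun i _ => Finset.sum_congr rfl fun j _ => ?_
  rw [Complex.re_ofReal_mul, ← Complex.ofReal_mul, Complex.exp_ofReal_mul_I_re, mul_neg_one,
    neg_sub]

/-- The autocorrelation at lag `j` of the sequence `b` truncated to `[0, M)`. The lag is unsigned,
so that each lag `j > 0` counts both `(n, n + j)` and `(n + j, n)`. -/
noncomputable def autocorr (b : ℕ → ℝ) (M j : ℕ) : ℝ :=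
  ∑ q ∈ Finset.range M ×ˢ Finset.range M with ((q.1 : ℤ) - q.2).natAbs = j, b q.1 * b q.2

theorem autocorr_nonneg {b : ℕ → ℝ} (hb : ∀ n, 0 ≤ b n) (M j : ℕ) : 0 ≤ autocorr b M j :=
  Finset.sum_nonneg fun _ _ => mul_nonneg (hb _) (hb _)

theorem autocorr_zero (b : ℕ → ℝ) (M : ℕ) : autocorr b M 0 = ∑ n ∈ Finset.range M, b n ^ 2 := by
  have hdiag : ((Finset.range M ×ˢ Finset.range M).filter
      fun q : ℕ × ℕ => ((q.1 : ℤ) - q.2).natAbs = 0) = (Finset.range M).diag := by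
    ext ⟨n, n'⟩
    simp only [Finset.mem_filter, Finset.mem_product, Finset.mem_diag, Finset.mem_range]
    omega
  simp only [autocorr, hdiag, Finset.sum_diag, pow_two]

theorem sum_fst_sq_le_two_mul_sum_sq (b : ℕ → ℝ) (M j : ℕ) :
    ∑ q ∈ Finset.range M ×ˢ Finset.range M with ((q.1 : ℤ) - q.2).natAbs = j, b q.1 ^ 2 ≤
      2 * ∑ n ∈ Finset.range M, b n ^ 2 := by
  have hmaps : ∀ q ∈ (Finset.range M ×ˢ Finset.range M).filter
      fun q : ℕ × ℕ => ((q.1 : ℤ) - q.2).natAbs = j, q.1 ∈ Finset.range M := fun q hq =>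
    (Finset.mem_product.1 (Finset.mem_filter.1 hq).1).1
  rw [← Finset.sum_fiberwise_of_maps_to hmaps, Finset.mul_sum]
  refine Finset.sum_le_sum fun n _ => ?_
  rw [Finset.sum_congr rfl (g := fun _ => b n ^ 2) fun q hq => by
    rw [(Finset.mem_filter.1 hq).2], Finset.sum_const, nsmul_eq_mul]
  refine mul_le_mul_of_nonneg_right ?_ (sq_nonneg _)
  have hsub : (((Finset.range M ×ˢ Finset.range M).filter
      fun q : ℕ × ℕ => ((q.1 : ℤ) - q.2).natAbs = j).filter fun q => q.1 = n) ⊆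
        {(n, n + j), (n, n - j)} := by
    rintro ⟨m, m'⟩ h
    simp only [Finset.mem_filter, Finset.mem_product, Finset.mem_range, Finset.mem_insert,
      Finset.mem_singleton, Prod.mk.injEq] at h ⊢
    omega
  exact_mod_cast (Finset.card_le_card hsub).trans Finset.card_le_two

theorem autocorr_le_two_mul_autocorr_zero (b : ℕ → ℝ) (M j : ℕ) :
    autocorr b M j ≤ 2 * autocorr b M 0 := by
  set D := (Finset.range M ×ˢ Finset.range M).filter
    fun q : ℕ × ℕ => ((q.1 : ℤ) - q.2).natAbs = j with hD
  have hswap : ∑ q ∈ D, b q.2 ^ 2 = ∑ q ∈ D, b q.1 ^ 2 := by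
    refine Finset.sum_nbij' Prod.swap Prod.swap ?_ ?_ (fun _ _ => rfl) (fun _ _ => rfl)
      (fun _ _ => rfl) <;>
    · rintro ⟨n, n'⟩ h
      simp only [hD, Finset.mem_filter, Finset.mem_product, Prod.swap_prod_mk,
        Finset.mem_range] at h ⊢
      omega
  have hamgm : autocorr b M j ≤ ∑ q ∈ D, (b q.1 ^ 2 + b q.2 ^ 2) / 2 :=
    Finset.sum_le_sum fun q _ => by linarith [two_mul_le_add_sq (b q.1) (b q.2)]
  rw [← Finset.sum_div, Finset.sum_add_distrib, hswap, add_self_div_two] at hamgm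
  exact hamgm.trans ((sum_fst_sq_le_two_mul_sum_sq b M j).trans_eq (by rw [autocorr_zero]))

theorem sum_autocorr_mul_cos (b : ℕ → ℝ) (M : ℕ) (θ : ℝ) :
    ∑ j ∈ Finset.range M, autocorr b M j * Real.cos (θ * j) =
      ‖∑ n ∈ Finset.range M, (b n : ℂ) * Complex.exp (θ * Complex.I) ^ n‖ ^ 2 := by
  have hpow : ∀ n : ℕ, Complex.exp (θ * Complex.I) ^ n =
      Complex.exp ((θ * n : ℝ) * Complex.I) := fun n => by
    rw [← Complex.exp_nat_mul]
    congr 1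
    push_cast
    ring
  have hmaps : ∀ q ∈ Finset.range M ×ˢ Finset.range M,
      ((q.1 : ℤ) - q.2).natAbs ∈ Finset.range M := by
    rintro ⟨n, n'⟩ h
    simp only [Finset.mem_product, Finset.mem_range] at h ⊢
    omega
  simp_rw [hpow]
  rw [norm_sq_exp_sum_eq_sum_cos, ← Finset.sum_product', ← Finset.sum_fiberwise_of_maps_to hmaps]
  refine Finset.sum_congr rfl fun j _ => ?_
  rw [autocorr, Finset.sum_mul]
  refine Finset.sum_congr rfl fun q hq => ?_
  rw [← (Finset.mem_filter.1 hq).2, Nat.cast_natAbs, ← mul_sub]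
  push_cast
  rcases abs_choice ((q.1 : ℝ) - q.2) with h | h
  · rw [h]
  · rw [h, mul_neg, Real.cos_neg]

theorem two_mul_distNearestInt_le_abs_sin (t : ℝ) :
    2 * distNearestInt t ≤ |Real.sin (Real.pi * t)| := by
  have hpi := Real.pi_pos
  have hperiod : |Real.sin (Real.pi * t)| = |Real.sin (Real.pi * (t - round t))| := by
    rw [mul_sub, mul_comm Real.pi (round t : ℝ), Real.sin_sub_int_mul_pi, abs_mul, abs_zpow,
      abs_neg, abs_one, one_zpow, one_mul]
  have hround : |Real.pi * (t - round t)| ≤ Real.pi / 2 := by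
    rw [abs_mul, abs_of_pos hpi]
    linarith [mul_le_mul_of_nonneg_left (abs_sub_round t) hpi.le]
  refine hperiod ▸ le_trans (le_of_eq ?_) (Real.mul_abs_le_abs_sin hround)
  rw [abs_mul, abs_of_pos hpi, distNearestInt]
  field_simp

theorem norm_geom_sum_exp_le (J : ℕ) {t : ℝ} (ht : 0 < distNearestInt t) :
    ‖∑ i ∈ Finset.range J, Complex.exp ((2 * Real.pi * t : ℝ) * Complex.I) ^ i‖ ≤
      1 / (2 * distNearestInt t) := by
  set e := Complex.exp ((2 * Real.pi * t : ℝ) * Complex.I) with he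
  have hdist : 2 * (2 * distNearestInt t) ≤ ‖e - 1‖ := by
    rw [he, mul_comm _ Complex.I, Complex.norm_exp_I_mul_ofReal_sub_one, Real.norm_eq_abs,
      abs_mul, abs_two, mul_assoc 2 Real.pi t, mul_div_cancel_left₀ _ two_ne_zero]
    exact mul_le_mul_of_nonneg_left (two_mul_distNearestInt_le_abs_sin t) zero_le_two
  have hpos : 0 < ‖e - 1‖ := by linarith
  have hnum : ‖e ^ J - 1‖ ≤ 2 := by
    refine (norm_sub_le _ _).trans_eq ?_
    rw [norm_pow, Complex.norm_exp_ofReal_mul_I, one_pow, norm_one, one_add_one_eq_two]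
  rw [geom_sum_eq (sub_ne_zero.1 (norm_pos_iff.1 hpos)), norm_div,
    div_le_div_iff₀ hpos (by linarith), one_mul]
  exact (mul_le_mul_of_nonneg_right hnum (by linarith)).trans hdist

/-- The power `(1 + X + ⋯ + X ^ (J - 1)) ^ r`; at `X = exp (2πit)` its squared modulus is a
Fejér-type kernel, concentrated at the integers `t`. -/
noncomputable def geomPow (J r : ℕ) : Polynomial ℝ :=
  (∑ i ∈ Finset.range J, Polynomial.X ^ i) ^ r

theorem natDegree_geomPow_le (J r : ℕ) : (geomPow J r).natDegree ≤ r * (J - 1) := by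
  refine Polynomial.natDegree_pow_le.trans (Nat.mul_le_mul_left _ ?_)
  refine Polynomial.natDegree_sum_le_of_forall_le _ _ fun i hi => ?_
  rw [Polynomial.natDegree_X_pow]
  have := Finset.mem_range.1 hi
  omega

theorem coeff_geomPow_nonneg (J r n : ℕ) : 0 ≤ (geomPow J r).coeff n := by
  have hmap : geomPow J r = ((∑ i ∈ Finset.range J, Polynomial.X ^ i : Polynomial ℕ) ^ r).map
      (Nat.castRingHom ℝ) := by
    simp [geomPow, Polynomial.map_pow, Polynomial.map_sum]
  rw [hmap, Polynomial.coeff_map]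
  exact Nat.cast_nonneg _

theorem pow_div_le_autocorr_geomPow {J r M : ℕ} (hJ : r * (J - 1) < M) :
    (J : ℝ) ^ (2 * r) / M ≤ autocorr (geomPow J r).coeff M 0 := by
  have heval := Polynomial.eval_eq_sum_range' ((natDegree_geomPow_le J r).trans_lt hJ) (1 : ℝ)
  have hcoeff : ∑ n ∈ Finset.range M, (geomPow J r).coeff n = (J : ℝ) ^ r := by
    simpa [geomPow, Polynomial.eval_finsetSum] using heval.symm
  rw [autocorr_zero, div_le_iff₀ (by exact_mod_cast (Nat.zero_le _).trans_lt hJ), mul_comm 2 r,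
    pow_mul, ← hcoeff, mul_comm]
  simpa using sq_sum_le_card_mul_sum_sq (s := Finset.range M) (f := (geomPow J r).coeff)

theorem sum_autocorr_geomPow_mul_cos_le {J r M : ℕ} (hJ : r * (J - 1) < M) {δ t : ℝ} (hδ : 0 < δ)
    (ht : δ ≤ distNearestInt t) :
    ∑ j ∈ Finset.range M, autocorr (geomPow J r).coeff M j * Real.cos (2 * Real.pi * t * j) ≤
      (1 / (2 * δ)) ^ (2 * r) := by
  set e := Complex.exp ((2 * Real.pi * t : ℝ) * Complex.I)
  have heval := Polynomial.eval₂_eq_sum_range' (algebraMap ℝ ℂ)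
    ((natDegree_geomPow_le J r).trans_lt hJ) e
  rw [geomPow, Polynomial.eval₂_pow, Polynomial.eval₂_finsetSum, ← geomPow] at heval
  simp only [Polynomial.eval₂_X_pow, Complex.coe_algebraMap] at heval
  have hbound : ‖∑ i ∈ Finset.range J, e ^ i‖ ≤ 1 / (2 * δ) :=
    (norm_geom_sum_exp_le J (hδ.trans_le ht)).trans
      (one_div_le_one_div_of_le (by linarith) (by linarith))
  rw [sum_autocorr_mul_cos, ← heval, norm_pow, ← pow_mul, mul_comm r 2]
  exact pow_le_pow_left₀ (norm_nonneg _) hbound _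

theorem exists_cos_kernel {δ : ℝ} (hδ : 0 < δ) {J r M : ℕ} (hJ : r * (J - 1) < M)
    (hM : 2 * (M : ℝ) ≤ (2 * δ * J) ^ (2 * r)) :
    ∃ c : ℕ → ℝ, 0 < c 0 ∧ (∀ j, 0 ≤ c j) ∧ (∀ j, c j ≤ 2 * c 0) ∧ ∀ t, δ ≤ distNearestInt t →
      ∑ j ∈ Finset.Ico 1 M, c j * Real.cos (2 * Real.pi * t * j) ≤ -(c 0 / 2) := by
  set c := autocorr (geomPow J r).coeff M
  have hM0 : (0 : ℝ) < M := by exact_mod_cast (Nat.zero_le _).trans_lt hJ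
  have hlarge : 2 * (1 / (2 * δ)) ^ (2 * r) ≤ c 0 := by
    refine le_trans ?_ (pow_div_le_autocorr_geomPow hJ)
    rw [le_div_iff₀ hM0, one_div, inv_pow, mul_right_comm, ← div_eq_mul_inv,
      div_le_iff₀ (by positivity), ← mul_pow, mul_comm (J : ℝ)]
    exact hM
  have hpos : 0 < (1 / (2 * δ)) ^ (2 * r) := by positivity
  refine ⟨c, by linarith, autocorr_nonneg (coeff_geomPow_nonneg J r) M,
    autocorr_le_two_mul_autocorr_zero _ M, fun t ht => ?_⟩
  have hker := sum_autocorr_geomPow_mul_cos_le hJ hδ ht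
  rw [Finset.range_eq_Ico, Finset.sum_eq_sum_Ico_succ_bot (Nat.cast_pos.1 hM0), Nat.cast_zero,
    mul_zero, Real.cos_zero, mul_one, zero_add] at hker
  linarith

end CosineKernel

section NoSmallGap

variable {ι : Type*} (P : Finset ι) (z : ι → ℝ) (c : ℕ → ℝ)

/-- The block of frequencies `j ∈ [K, 2K)` of the sum over `p ∈ P` of the exponential polynomials
with coefficients `c j`, evaluated at the dilates `α * z p`. -/
noncomputable def dyadicBlock (K : ℕ) (α : ℝ) : ℂ :=
  ∑ p ∈ Finset.Ico K (2 * K) ×ˢ P, (c p.1 : ℂ) *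
    Complex.exp (-(α * (2 * Real.pi * (p.1 * z p.2)) : ℝ) * Complex.I)

theorem dyadicBlock_re (K : ℕ) (α : ℝ) : (dyadicBlock P z c K α).re =
    ∑ j ∈ Finset.Ico K (2 * K), ∑ p ∈ P, c j * Real.cos (2 * Real.pi * (α * z p) * j) := by
  rw [dyadicBlock, Complex.re_sum, Finset.sum_product]
  refine Finset.sum_congr rfl fun j _ => Finset.sum_congr rfl fun p _ => ?_
  rw [Complex.re_ofReal_mul, ← Complex.ofReal_neg, Complex.exp_ofReal_mul_I_re, Real.cos_neg]
  congr 2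
  ring

theorem sum_Ico_one_two_pow (f : ℕ → ℝ) (n : ℕ) :
    ∑ j ∈ Finset.Ico 1 (2 ^ n), f j =
      ∑ i ∈ Finset.range n, ∑ j ∈ Finset.Ico (2 ^ i : ℕ) (2 * 2 ^ i), f j := by
  induction n with
  | zero => simp
  | succ n ih =>
    rw [Finset.sum_range_succ, ← ih, ← pow_succ',
      Finset.sum_Ico_consecutive _ Nat.one_le_two_pow (Nat.pow_le_pow_right two_pos n.le_succ)]

theorem sq_le_sum_norm_sq_dyadicBlock {b α : ℝ} (hb : 0 ≤ b) {I : ℕ}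
    (h : ∀ p ∈ P, ∑ j ∈ Finset.Ico 1 (2 ^ I), c j * Real.cos (2 * Real.pi * (α * z p) * j) ≤ -b) :
    (P.card * b) ^ 2 ≤ I * ∑ i ∈ Finset.range I, ‖dyadicBlock P z c (2 ^ i) α‖ ^ 2 := by
  have hsum : ∑ i ∈ Finset.range I, (dyadicBlock P z c (2 ^ i) α).re ≤ -(P.card * b) := by
    have hP := Finset.sum_le_card_nsmul _ _ _ h
    rw [Finset.sum_comm, sum_Ico_one_two_pow, nsmul_eq_mul, mul_neg] at hP
    simpa only [dyadicBlock_re] using hP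
  have hcauchy := sq_sum_le_card_mul_sum_sq (s := Finset.range I)
    (f := fun i => (dyadicBlock P z c (2 ^ i) α).re)
  rw [Finset.card_range] at hcauchy
  have hPb : 0 ≤ P.card * b := by positivity
  refine (pow_le_pow_left₀ hPb (le_neg_of_le_neg hsum) 2).trans ?_
  rw [neg_sq]
  refine hcauchy.trans (mul_le_mul_of_nonneg_left (Finset.sum_le_sum fun i _ => ?_)
    (Nat.cast_nonneg I))
  exact sq_le_sq' (abs_le.1 (Complex.abs_re_le_norm _)).1 (Complex.re_le_norm _)

variable {c}

theorem integrable_norm_sq_dyadicBlock (hc : ∀ j, 0 ≤ c j) (K : ℕ) (v : NNReal) :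
    Integrable (fun α => ‖dyadicBlock P z c K α‖ ^ 2) (gaussianReal 0 v) := by
  have hcont : Continuous (dyadicBlock P z c K) := by unfold dyadicBlock; fun_prop
  have hmeas := hcont.aestronglyMeasurable (μ := gaussianReal 0 v)
  refine (memLp_two_iff_integrable_sq_norm hmeas).1 (memLp_of_norm_le_linear hmeas
    (∑ p ∈ Finset.Ico K (2 * K) ×ˢ P, c p.1) 0 (fun α => ?_) (by simp))
  rw [zero_mul, add_zero]
  exact norm_exp_sum_le _ (fun p _ => hc p.1) _ α

theorem exp_neg_two_pi_sq_le (w : ℝ) {H : ℝ} (hH : 0 ≤ H) :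
    Real.exp (-(2 * Real.pi * w) ^ 2 / 2) ≤ (if |w| ≤ H then 1 else 0) + Real.exp (-H ^ 2) := by
  split_ifs with h
  · refine (Real.exp_le_one_iff.2 ?_).trans (le_add_of_nonneg_right (Real.exp_nonneg _))
    linarith [sq_nonneg (2 * Real.pi * w)]
  · rw [zero_add, Real.exp_le_exp, mul_pow]
    have hw : H ^ 2 ≤ w ^ 2 := sq_abs w ▸ pow_le_pow_left₀ hH (not_le.1 h).le 2
    have hpi : 2 ≤ (2 * Real.pi) ^ 2 := by nlinarith [Real.pi_gt_three]
    linarith [mul_le_mul_of_nonneg_right hpi (sq_nonneg w)]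

theorem sum_ite_dilate_eq_dilateEnergy (K : ℕ) (H : ℝ) :
    ∑ p ∈ Finset.Ico K (2 * K) ×ˢ P, ∑ q ∈ Finset.Ico K (2 * K) ×ˢ P,
      (if |p.1 * z p.2 - q.1 * z q.2| ≤ H then (1 : ℝ) else 0) = dilateEnergy P z K H := by
  rw [Finset.sum_product, dilateEnergy, Nat.cast_sum]
  refine Finset.sum_congr rfl fun j _ => ?_
  rw [Finset.sum_congr rfl fun p _ => Finset.sum_product _ _ _, Finset.sum_comm, Nat.cast_sum]
  refine Finset.sum_congr rfl fun l _ => ?_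
  rw [closeDilates, Finset.card_filter, Finset.sum_product]
  push_cast
  rfl

theorem integral_norm_sq_dyadicBlock_le {C H : ℝ} (hc : ∀ j, 0 ≤ c j) (hC : ∀ j, c j ≤ C)
    (hH : 0 ≤ H) (K : ℕ) :
    ∫ α, ‖dyadicBlock P z c K α‖ ^ 2 ∂(gaussianReal 0 1) ≤
      C ^ 2 * (dilateEnergy P z K H + (K * P.card) ^ 2 * Real.exp (-H ^ 2)) := by
  simp only [dyadicBlock]
  rw [integral_norm_sq_exp_sum_gaussianReal (Finset.Ico K (2 * K) ×ˢ P) (fun p => c p.1)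
    (fun p => 2 * Real.pi * (p.1 * z p.2))]
  have hcoeff : ∀ j l, c j * c l ≤ C ^ 2 := fun j l =>
    (mul_le_mul (hC j) (hC l) (hc l) ((hc j).trans (hC j))).trans_eq (pow_two C).symm
  have hterm : ∀ p q : ℕ × ι, c p.1 * c q.1 * Real.exp (-(((1 : NNReal) : ℝ) *
      (2 * Real.pi * (p.1 * z p.2) - 2 * Real.pi * (q.1 * z q.2)) ^ 2) / 2) ≤
      C ^ 2 * ((if |p.1 * z p.2 - q.1 * z q.2| ≤ H then 1 else 0) + Real.exp (-H ^ 2)) :=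
    fun p q => by
      rw [NNReal.coe_one, one_mul, ← mul_sub]
      exact mul_le_mul (hcoeff _ _) (exp_neg_two_pi_sq_le _ hH) (Real.exp_nonneg _) (sq_nonneg C)
  refine (Finset.sum_le_sum fun p _ => Finset.sum_le_sum fun q _ => hterm p q).trans_eq ?_
  simp_rw [← Finset.mul_sum, Finset.sum_add_distrib]
  rw [sum_ite_dilate_eq_dilateEnergy]
  simp only [Finset.sum_const, Finset.card_product, Nat.card_Ico, nsmul_eq_mul]
  rw [two_mul, Nat.add_sub_cancel]
  push_cast
  ring

theorem measure_forall_le_distNearestInt_le {P : Finset ι} (hP : P.Nonempty) {δ V H : ℝ}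
    {J r I : ℕ} (hδ : 0 < δ) (hr : r * (J - 1) < 2 ^ I)
    (hδJ : 2 * (2 : ℝ) ^ I ≤ (2 * δ * J) ^ (2 * r)) (hH : 0 ≤ H)
    (hV : ∀ i < I, dilateEnergy P z (2 ^ i) H +
      ((2 ^ i : ℕ) * P.card : ℝ) ^ 2 * Real.exp (-H ^ 2) ≤ V) :
    (gaussianReal 0 1).real {α | ∀ p ∈ P, δ ≤ distNearestInt (α * z p)} ≤
      16 * I ^ 2 * V / P.card ^ 2 := by
  obtain ⟨c, hc₀, hc, hcle, hker⟩ := exists_cos_kernel hδ hr (by exact_mod_cast hδJ)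
  set X : ℝ → ℝ := fun α => I * ∑ i ∈ Finset.range I, ‖dyadicBlock P z c (2 ^ i) α‖ ^ 2
  have hint : ∀ i ∈ Finset.range I,
      Integrable (fun α => ‖dyadicBlock P z c (2 ^ i) α‖ ^ 2) (gaussianReal 0 1) := fun i _ =>
    integrable_norm_sq_dyadicBlock P z hc (2 ^ i) 1
  have hmean : ∫ α, X α ∂(gaussianReal 0 1) ≤ I * (I * ((2 * c 0) ^ 2 * V)) := by
    rw [integral_const_mul, integral_finsetSum _ hint]
    refine mul_le_mul_of_nonneg_left ?_ (Nat.cast_nonneg I)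
    have hblock := Finset.sum_le_card_nsmul _ _ _ fun i hi =>
      (integral_norm_sq_dyadicBlock_le P z hc hcle hH (2 ^ i)).trans
        (mul_le_mul_of_nonneg_left (hV i (Finset.mem_range.1 hi)) (sq_nonneg _))
    rwa [Finset.card_range, nsmul_eq_mul] at hblock
  have hsub : {α | ∀ p ∈ P, δ ≤ distNearestInt (α * z p)} ⊆
      {α | (P.card * (c 0 / 2)) ^ 2 ≤ X α} := fun α hα =>
    sq_le_sum_norm_sq_dyadicBlock P z c (by positivity) fun p hp => hker _ (hα p hp)
  have hmarkov := (mul_meas_ge_le_integral_of_nonneg (μ := gaussianReal 0 1)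
    (Eventually.of_forall fun α => by positivity) ((integrable_finsetSum _ hint).const_mul _)
    ((P.card * (c 0 / 2)) ^ 2)).trans hmean
  have hcard : (0 : ℝ) < P.card := Nat.cast_pos.2 hP.card_pos
  rw [← le_div_iff₀' (by positivity)] at hmarkov
  refine (measureReal_mono hsub).trans (hmarkov.trans_eq ?_)
  field_simp
  ring

end NoSmallGap

/-! ### Pairs of terms with a large difference -/

section FarPairs

/-- The difference of the terms of the sequence `x` at a pair of indices. -/
def pairDiff (x : ℕ → ℝ) (p : ℕ × ℕ) : ℝ := x p.1 - x p.2

theorem closePairs_pairDiff_le_addEnergy (x : ℕ → ℝ) {N : ℕ} {P : Finset (ℕ × ℕ)}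
    (hP : P ⊆ Finset.Icc 1 N ×ˢ Finset.Icc 1 N) : closePairs P (pairDiff x) ≤ addEnergy x N := by
  unfold closePairs addEnergy addEnergyAt
  refine Finset.card_le_card_of_injOn (fun r => (r.1.1, r.2.2, r.1.2, r.2.1)) ?_ ?_
  · rintro ⟨p, q⟩ h
    rw [Finset.mem_coe, Finset.mem_filter] at h ⊢
    simp only [Finset.mem_product, pairDiff] at h ⊢
    have hp := Finset.mem_product.1 (hP h.1.1)
    have hq := Finset.mem_product.1 (hP h.1.2)
    refine ⟨⟨hp.1, hq.2, hp.2, hq.1⟩, ?_⟩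
    rw [show x p.1 + x q.2 - x p.2 - x q.1 = x p.1 - x p.2 - (x q.1 - x q.2) by ring]
    exact h.2
  · rintro ⟨⟨i, j⟩, i', j'⟩ _ ⟨⟨k, l⟩, k', l'⟩ _ h
    simp only [Prod.mk.injEq] at h ⊢
    tauto

theorem card_sq_le_mul_closePairs {ι : Type*} (A : Finset ι) (z : ι → ℝ) {B : ℝ} (hB : 0 ≤ B)
    (hz : ∀ p ∈ A, |z p| ≤ B) : (A.card : ℝ) ^ 2 ≤ (2 * B + 2) * closePairs A z := by
  set U := Finset.Icc ⌊-B⌋ ⌊B⌋ with hU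
  have hmaps : ∀ p ∈ A, ⌊z p⌋ ∈ U := fun p hp =>
    Finset.mem_Icc.2 ⟨Int.floor_le_floor (abs_le.1 (hz p hp)).1,
      Int.floor_le_floor (abs_le.1 (hz p hp)).2⟩
  have hcard : (A.card : ℝ) = ∑ n ∈ U, ((A.filter fun p => ⌊z p⌋ = n).card : ℝ) := by
    exact_mod_cast Finset.card_eq_sum_card_fiberwise hmaps
  have hfibre : ∑ n ∈ U, ((A.filter fun p => ⌊z p⌋ = n).card : ℝ) ^ 2 ≤ closePairs A z := by
    have hfloor := card_filter_floor_eq_le_closePairs A z le_rfl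
    simp only [one_mul] at hfloor
    rw [card_filter_eq_sum_mul A A (fun p => ⌊z p⌋) (fun p => ⌊z p⌋) hmaps] at hfloor
    simp_rw [pow_two]
    exact_mod_cast hfloor
  have hUcard : (U.card : ℝ) ≤ 2 * B + 2 := by
    have hneg : ⌊-B⌋ ≤ ⌊B⌋ := Int.floor_le_floor (by linarith)
    rw [hU, Int.card_Icc, ← Int.cast_natCast, Int.toNat_of_nonneg (by omega)]
    push_cast
    linarith [Int.floor_le B, Int.lt_floor_add_one (-B)]
  rw [hcard]
  exact sq_sum_le_card_mul_sum_sq.trans (mul_le_mul hUcard hfibre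
    (Finset.sum_nonneg fun _ _ => sq_nonneg _) (by linarith))

/-- The pairs of indices up to `N` at which the difference of the terms of `x` is at least `B`. -/
noncomputable def farPairs (x : ℕ → ℝ) (N : ℕ) (B : ℝ) : Finset (ℕ × ℕ) :=
  (Finset.Icc 1 N ×ˢ Finset.Icc 1 N).filter fun p => B ≤ pairDiff x p

theorem card_farPairs_le (x : ℕ → ℝ) (N : ℕ) (B : ℝ) : (farPairs x N B).card ≤ N ^ 2 := by
  refine (Finset.card_filter_le _ _).trans_eq ?_
  rw [Finset.card_product, Nat.card_Icc, Nat.add_sub_cancel, pow_two]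

theorem sq_div_four_le_card_farPairs {x : ℕ → ℝ} {N : ℕ} {B : ℝ} (hB : 0 ≤ B)
    (hE : (2 * B + 2) * addEnergy x N ≤ ((N : ℝ) ^ 2 / 2) ^ 2) :
    (N : ℝ) ^ 2 / 4 ≤ (farPairs x N B).card := by
  set Q := Finset.Icc 1 N ×ˢ Finset.Icc 1 N with hQ
  set A := Q.filter fun p => |pairDiff x p| ≤ B
  have hnear : (A.card : ℝ) ≤ (N : ℝ) ^ 2 / 2 := by
    refine le_of_sq_le_sq ((card_sq_le_mul_closePairs A (pairDiff x) hB fun p hp =>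
      (Finset.mem_filter.1 hp).2).trans ((mul_le_mul_of_nonneg_left ?_ (by linarith)).trans hE))
      (by positivity)
    exact_mod_cast closePairs_pairDiff_le_addEnergy x (Finset.filter_subset _ _)
  have hsplit : Q ⊆ farPairs x N B ∪ (farPairs x N B).image Prod.swap ∪ A := fun p hp => by
    have hswap : p.swap ∈ Q := Finset.mem_product.2 (Finset.mem_product.1 hp).symm
    simp only [Finset.mem_union, farPairs, A, Finset.mem_filter, ← hQ, hp, true_and]
    rcases le_total B (pairDiff x p) with h | h
    · exact .inl (.inl h)
    rcases le_total B (pairDiff x p.swap) with h' | h'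
    · exact .inl (.inr (Finset.mem_image.2 ⟨p.swap, Finset.mem_filter.2 ⟨hswap, h'⟩, p.swap_swap⟩))
    · refine .inr (abs_le.2 ⟨?_, h⟩)
      simp only [pairDiff, Prod.fst_swap, Prod.snd_swap] at h' ⊢
      linarith
  have hcard : N ^ 2 ≤ (farPairs x N B).card + (farPairs x N B).card + A.card := by
    have hQcard : Q.card = N ^ 2 := by
      rw [Finset.card_product, Nat.card_Icc, Nat.add_sub_cancel, pow_two]
    rw [← hQcard]
    exact (Finset.card_le_card hsplit).trans ((Finset.card_union_le _ _).trans (Nat.add_le_add_right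
      ((Finset.card_union_le _ _).trans (Nat.add_le_add_left Finset.card_image_le _)) _))
  have hcard' : (N : ℝ) ^ 2 ≤ (farPairs x N B).card + (farPairs x N B).card + A.card := by
    exact_mod_cast hcard
  linarith

theorem metricMinGap_le_of_mem_farPairs {x : ℕ → ℝ} {N : ℕ} {B : ℝ} (hB : 0 < B) {p : ℕ × ℕ}
    (hp : p ∈ farPairs x N B) (α : ℝ) :
    metricMinGap x α N ≤ distNearestInt (α * pairDiff x p) := by
  obtain ⟨hmem, hfar⟩ := Finset.mem_filter.1 hp
  obtain ⟨hp₁, hp₂⟩ := Finset.mem_product.1 hmem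
  have hne : p.1 ≠ p.2 := fun h => hB.not_ge (by simpa [pairDiff, h] using hfar)
  have hN : 2 ≤ N := by
    rw [Finset.mem_Icc] at hp₁ hp₂
    omega
  refine (minGap_isLeast (fun n => α * x n) hN).2 ⟨p.1, hp₁, p.2, hp₂, hne, ?_⟩
  rw [pairDiff, mul_sub]

end FarPairs

/-! ### Choice of parameters -/

section Asymptotics

theorem eventually_const_mul_rpow_le (C : ℝ) {p q : ℝ} (h : p < q) :
    ∀ᶠ X : ℝ in atTop, C * X ^ p ≤ X ^ q := by
  filter_upwards [(tendsto_rpow_atTop (sub_pos.2 h)).eventually_ge_atTop C, eventually_gt_atTop 0]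
    with X hC hX
  rw [← sub_add_cancel q p, Real.rpow_add hX]
  exact mul_le_mul_of_nonneg_right hC (by positivity)

theorem eventually_rpow_mul_exp_neg_le_one (p : ℝ) {q : ℝ} (hq : 0 < q) :
    ∀ᶠ X : ℝ in atTop, X ^ p * Real.exp (-X ^ q) ≤ 1 := by
  have h := (tendsto_rpow_mul_exp_neg_mul_atTop_nhds_zero (p / q) 1 one_pos).comp
    (tendsto_rpow_atTop hq)
  filter_upwards [h.eventually_le_const (zero_lt_one' ℝ), eventually_gt_atTop 0] with X hle hX
  simp only [Function.comp_apply, neg_mul, one_mul] at hle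
  rwa [← Real.rpow_mul hX.le, mul_div_cancel₀ _ hq.ne'] at hle

theorem eventually_forall_const_mul_sq_le_rpow {D : ℝ} (hD : 0 ≤ D) (a : ℝ) {q : ℝ} (hq : 0 < q) :
    ∀ᶠ X : ℝ in atTop, ∀ I : ℕ, (2 : ℝ) ^ I ≤ X ^ a → D * (I : ℝ) ^ 2 ≤ X ^ q := by
  have hlog2 := Real.log_pos one_lt_two
  have hsmall : ∀ᶠ X : ℝ in atTop, D * (a / Real.log 2) ^ 2 * Real.log X ^ (2 : ℝ) ≤ X ^ q := by
    have h := ((isLittleO_log_rpow_rpow_atTop 2 hq).const_mul_left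
      (D * (a / Real.log 2) ^ 2)).bound one_pos
    filter_upwards [h, eventually_ge_atTop 0] with X hX hX₀
    rw [one_mul, Real.norm_of_nonneg (Real.rpow_nonneg hX₀ q)] at hX
    exact (le_abs_self _).trans hX
  filter_upwards [hsmall, eventually_gt_atTop 0] with X hX hX₀ I hI
  have hIX : (I : ℝ) ≤ a / Real.log 2 * Real.log X := by
    have h := Real.log_le_log (by positivity) hI
    rw [Real.log_pow, Real.log_rpow hX₀] at h
    rwa [div_mul_eq_mul_div, le_div_iff₀ hlog2]
  refine le_trans ?_ hX
  rw [mul_assoc, Real.rpow_two, ← mul_pow]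
  exact mul_le_mul_of_nonneg_left (pow_le_pow_left₀ (Nat.cast_nonneg I) hIX 2) hD

theorem eventually_sq_div_four_le_card_farPairs {x : ℕ → ℝ} {b ε : ℝ} (hb : 0 ≤ b)
    (henergy : ∀ᶠ N : ℕ in atTop, (addEnergy x N : ℝ) ≤ (N : ℝ) ^ (2 + ε)) (hbε : b + ε < 2) :
    ∀ᶠ N : ℕ in atTop, (N : ℝ) ^ 2 / 4 ≤ (farPairs x N ((N : ℝ) ^ b)).card := by
  filter_upwards [henergy, eventually_ge_atTop 1, tendsto_natCast_atTop_atTop.eventually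
    (eventually_const_mul_rpow_le 16 (show b + (2 + ε) < 4 by linarith))] with N hE hN hpow
  have hN1 : (1 : ℝ) ≤ N := by exact_mod_cast hN
  have hB : 1 ≤ (N : ℝ) ^ b := Real.one_le_rpow hN1 hb
  refine sq_div_four_le_card_farPairs (zero_le_one.trans hB) ?_
  rw [Real.rpow_add (by positivity), Real.rpow_ofNat] at hpow
  calc (2 * (N : ℝ) ^ b + 2) * addEnergy x N ≤ 4 * (N : ℝ) ^ b * (N : ℝ) ^ (2 + ε) :=
        mul_le_mul (by linarith) hE (Nat.cast_nonneg _) (by linarith)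
    _ ≤ ((N : ℝ) ^ 2 / 2) ^ 2 := by linarith

theorem exists_kernel_parameters {a τ : ℝ} (h : τ < a) :
    ∃ r : ℕ, ∀ᶠ X : ℝ in atTop, ∀ M : ℕ, 0 < M → (M : ℝ) ≤ X ^ a → X ^ a ≤ 2 * M →
      ∃ J : ℕ, r * (J - 1) < M ∧ 2 * (M : ℝ) ≤ (2 * X ^ (-τ) * J) ^ (2 * r) := by
  obtain ⟨n, hn⟩ := exists_nat_gt (a / (2 * (a - τ)))
  set r := n + 1
  have hr : a < (a - τ) * (2 * r : ℕ) := by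
    rw [div_lt_iff₀ (by linarith)] at hn
    push_cast [r]
    linarith
  refine ⟨r, ?_⟩
  filter_upwards [eventually_const_mul_rpow_le (2 * (r : ℝ) ^ (2 * r)) hr, eventually_gt_atTop 0]
    with X hX hX₀ M hM hMX hXM
  -- `J = ⌈M / r⌉`
  refine ⟨(M - 1) / r + 1, ?_, ?_⟩
  · rw [Nat.add_sub_cancel]
    exact (Nat.mul_div_le _ _).trans_lt (by omega)
  set J := (M - 1) / r + 1
  have hJ : (M : ℝ) ≤ r * J := by
    have hlt : M - 1 < r * J := Nat.lt_mul_div_succ _ n.succ_pos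
    exact_mod_cast (by omega : M ≤ r * J)
  have hbase : X ^ (a - τ) / r ≤ 2 * X ^ (-τ) * J := by
    rw [div_le_iff₀ (by positivity), sub_eq_neg_add, Real.rpow_add hX₀]
    calc X ^ (-τ) * X ^ a ≤ X ^ (-τ) * (2 * (r * J)) := by gcongr; linarith
      _ = 2 * X ^ (-τ) * J * r := by ring
  refine le_trans ?_ (pow_le_pow_left₀ (by positivity) hbase (2 * r))
  rw [div_pow, le_div_iff₀ (by positivity), ← Real.rpow_mul_natCast hX₀.le]
  refine le_trans ?_ hX
  rw [mul_right_comm]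
  gcongr

end Asymptotics

section PowerBounds

variable {κ m ε : ℝ}

theorem exists_small_exponent {τ : ℝ} (hτ : τ < 2) (h : τ * (κ + 4 * m) < 2 * κ - 4) :
    ∃ ε : ℝ, 0 < ε ∧ τ + ε + 2 * ε + ε < 2 ∧
      τ + ε + (2 - (τ + ε) - 2 * ε) * (1 - κ / 2) + (2 * (τ + ε) + ε) * (m + ε) ≤ -ε := by
  have hlt : ∀ᶠ ε : ℝ in 𝓝 0, τ + ε + 2 * ε + ε < 2 :=
    ContinuousAt.eventually_lt (by fun_prop) continuousAt_const (by simpa using hτ)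
  have hexp : ∀ᶠ ε : ℝ in 𝓝 0,
      τ + ε + (2 - (τ + ε) - 2 * ε) * (1 - κ / 2) + (2 * (τ + ε) + ε) * (m + ε) < -ε :=
    ContinuousAt.eventually_lt (by fun_prop) (by fun_prop) (by ring_nf at h ⊢; linarith)
  obtain ⟨ε, ⟨h₁, h₂⟩, hε⟩ :=
    (((hlt.and hexp).filter_mono nhdsWithin_le_nhds).and
      (eventually_mem_nhdsWithin (a := (0 : ℝ)) (s := Set.Ioi 0))).exists
  exact ⟨ε, hε, h₁, h₂.le⟩

theorem gaussianMoment_le_rpow {C T₀ σ : ℝ} (hC : 0 ≤ C) (hσ : 0 ≤ σ)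
    (hmoment : ∀ T, T₀ ≤ T → gaussianMoment κ T ≤ C * T ^ σ) {X a : ℝ} {K : ℕ} (hX : 1 ≤ X)
    (hXT : T₀ ≤ X ^ ε) (hK : 1 ≤ K) (hKX : (K : ℝ) ≤ X ^ a) :
    gaussianMoment κ (K ^ 2 * X ^ ε) ≤ C * X ^ ((2 * a + ε) * σ) := by
  have hX0 : 0 < X := one_pos.trans_le hX
  have hK1 : (1 : ℝ) ≤ K := by exact_mod_cast hK
  have hpow : (K : ℝ) ^ 2 * X ^ ε ≤ X ^ (2 * a + ε) := by
    rw [Real.rpow_add hX0, mul_comm 2 a, Real.rpow_mul hX0.le, Real.rpow_two]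
    gcongr
  refine (hmoment _ (hXT.trans (le_mul_of_one_le_left (by positivity) (one_le_pow₀ hK1)))).trans ?_
  rw [Real.rpow_mul hX0.le]
  gcongr

theorem exists_logForm_le_rpow (hκ : 2 ≤ κ) (hε : 0 < ε) (hζ : ZetaMomentBound κ m) :
    ∃ C T₀ : ℝ, 0 < C ∧ ∀ (X a : ℝ) (K : ℕ) (S : Finset ℤ) (v : ℤ → ℝ),
      1 ≤ X → T₀ ≤ X ^ ε → 1 ≤ K → (K : ℝ) ≤ X ^ a →
      (∀ k, 0 ≤ v k) → ∑ k ∈ S, v k ≤ X ^ 2 → ∑ k ∈ S, v k ^ 2 ≤ X ^ (2 + ε) →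
      a + (2 - a - 2 * ε) * (1 - κ / 2) + (2 * a + ε) * (m + ε) ≤ -ε →
      logForm (K ^ 2 * X ^ ε) K S v ≤ C * X ^ (4 - ε) := by
  obtain ⟨C, T₀, hC, -, hmoment⟩ := hζ.exists_gaussianMoment_le (by linarith) hε
  obtain ⟨D, hD, hform⟩ := exists_logForm_le
  refine ⟨D * (2 + C), T₀, by positivity, fun X a K S v hX hXT hK hKX hv hv₁ hv₂ hexp => ?_⟩
  have hX0 : 0 < X := one_pos.trans_le hX
  set V := ∑ k ∈ S, v k
  set W := ∑ k ∈ S, v k ^ 2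
  set T := (K : ℝ) ^ 2 * X ^ ε with hT
  -- The truncation level `L` is the largest for which the term `K * L * W` is acceptable.
  set L := X ^ (2 - a - 2 * ε) with hL
  have hL0 : 0 < L := by positivity
  have hV4 : V ^ 2 ≤ X ^ (4 : ℝ) := by
    refine (pow_le_pow_left₀ (Finset.sum_nonneg fun k _ => hv k) hv₁ 2).trans_eq ?_
    rw [← pow_mul, Real.rpow_ofNat]
  have hdiag : K ^ 2 * V ^ 2 / T ≤ X ^ (4 - ε) := by
    rw [hT, mul_div_mul_left _ _ (by positivity), Real.rpow_sub hX0]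
    gcongr
  have hshort : K * (L * W) ≤ X ^ (4 - ε) :=
    calc K * (L * W) ≤ X ^ a * (X ^ (2 - a - 2 * ε) * X ^ (2 + ε)) := by gcongr
      _ = X ^ (4 - ε) := by
        rw [← Real.rpow_add hX0, ← Real.rpow_add hX0]
        ring_nf
  have hzeta : K * (L ^ (1 - κ / 2) * (V ^ 2 * gaussianMoment κ T)) ≤ C * X ^ (4 - ε) := by
    have hM := gaussianMoment_le_rpow hC.le (add_nonneg (hζ.nonneg hκ) hε.le) hmoment hX hXT hK hKX
    calc K * (L ^ (1 - κ / 2) * (V ^ 2 * gaussianMoment κ T))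
        ≤ X ^ a * (L ^ (1 - κ / 2) * (X ^ (4 : ℝ) * (C * X ^ ((2 * a + ε) * (m + ε))))) := by
          have hnn : 0 ≤ gaussianMoment κ T := gaussianMoment_nonneg _ _
          gcongr
      _ = C * X ^ (4 + (a + (2 - a - 2 * ε) * (1 - κ / 2) + (2 * a + ε) * (m + ε))) := by
          rw [hL, ← Real.rpow_mul hX0.le, Real.rpow_add hX0, Real.rpow_add hX0, Real.rpow_add hX0]
          ring
      _ ≤ C * X ^ (4 - ε) := by
          gcongr
          linarith
  refine (hform κ T L K S v hκ (by positivity) hL0 hK hv).trans ?_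
  rw [mul_assoc]
  exact mul_le_mul_of_nonneg_left (by linarith) hD.le

variable {ι : Type*}

theorem exists_dilateEnergy_le_rpow (hκ : 2 ≤ κ) (hε : 0 < ε) (hζ : ZetaMomentBound κ m) :
    ∃ C T₀ : ℝ, 0 < C ∧ ∀ (P : Finset ι) (z : ι → ℝ) (X a : ℝ) (K H : ℕ),
      1 ≤ X → T₀ ≤ X ^ ε → 1 ≤ K → (K : ℝ) ≤ X ^ a → 1 ≤ H → (H : ℝ) ≤ X ^ ε →
      (P.card : ℝ) ≤ X ^ 2 → (closePairs P z : ℝ) ≤ X ^ (2 + ε) →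
      (∀ p ∈ P, X ^ (a + 2 * ε) ≤ z p) →
      a + (2 - a - 2 * ε) * (1 - κ / 2) + (2 * a + ε) * (m + ε) ≤ -ε →
      dilateEnergy P z K H ≤ C * H * X ^ (4 - ε) := by
  obtain ⟨C, T₀, hC, hform⟩ := exists_logForm_le_rpow hκ hε hζ
  refine ⟨9 * Real.exp 2 * C, T₀, by positivity,
    fun P z X a K H hX hXT hK hKX hH hHX hP hclose hz hexp => ?_⟩
  have hX0 : 0 < X := one_pos.trans_le hX
  have hTB : K ^ 2 * X ^ ε * H ≤ K * X ^ (a + 2 * ε) :=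
    calc K ^ 2 * X ^ ε * H = K * (K * (X ^ ε * H)) := by ring
      _ ≤ K * (X ^ a * (X ^ ε * X ^ ε)) := by gcongr
      _ = K * X ^ (a + 2 * ε) := by rw [← Real.rpow_add hX0, ← Real.rpow_add hX0, two_mul]
  set T := (K : ℝ) ^ 2 * X ^ ε
  calc (dilateEnergy P z K H : ℝ)
      ≤ 9 * H * Real.exp 2 * logForm T K (windowSet P z T) (windowWeight P z T) :=
        dilateEnergy_le_logForm (by positivity) (by positivity) hK hH hTB hz
    _ ≤ 9 * H * Real.exp 2 * (C * X ^ (4 - ε)) := by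
        gcongr
        exact hform X a K _ _ hX hXT hK hKX (windowWeight_nonneg P z T)
          ((sum_windowWeight_le P z T).trans hP) ((sum_windowWeight_sq_le P z T).trans hclose) hexp
    _ = 9 * Real.exp 2 * C * H * X ^ (4 - ε) := by ring

theorem eventually_mul_sq_mul_exp_le (a : ℝ) (hε : 0 < ε) :
    ∀ᶠ X : ℝ in atTop, ∀ H Q K : ℝ, X ^ (ε / 4) ≤ H → 0 ≤ Q → Q ≤ X ^ 2 → 0 ≤ K → K ≤ X ^ a →
      (K * Q) ^ 2 * Real.exp (-H ^ 2) ≤ X ^ (4 - ε / 2) := by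
  filter_upwards [eventually_rpow_mul_exp_neg_le_one (2 * a + ε / 2) (half_pos hε),
    eventually_gt_atTop 0] with X hexp hX0 H Q K hH hQ0 hQ hK0 hK
  have hHsq : X ^ (ε / 2) ≤ H ^ 2 := by
    rw [show ε / 2 = ε / 4 * (2 : ℕ) by push_cast; ring, Real.rpow_mul_natCast hX0.le]
    exact pow_le_pow_left₀ (by positivity) hH 2
  have hpow : (X ^ a * X ^ 2) ^ 2 = X ^ (4 - ε / 2) * X ^ (2 * a + ε / 2) := by
    rw [← Real.rpow_add hX0, ← Real.rpow_two X, ← Real.rpow_add hX0, ← Real.rpow_two,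
      ← Real.rpow_mul hX0.le]
    ring_nf
  calc (K * Q) ^ 2 * Real.exp (-H ^ 2) ≤ (X ^ a * X ^ 2) ^ 2 * Real.exp (-X ^ (ε / 2)) := by gcongr
    _ = X ^ (4 - ε / 2) * (X ^ (2 * a + ε / 2) * Real.exp (-X ^ (ε / 2))) := by
        rw [hpow, mul_assoc]
    _ ≤ X ^ (4 - ε / 2) := mul_le_of_le_one_right (by positivity) hexp

theorem eventually_exists_dilateEnergy_add_le (hκ : 2 ≤ κ) (hε : 0 < ε) (hζ : ZetaMomentBound κ m)
    {a : ℝ} (hexp : a + (2 - a - 2 * ε) * (1 - κ / 2) + (2 * a + ε) * (m + ε) ≤ -ε) :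
    ∀ᶠ X : ℝ in atTop, ∃ H : ℕ, ∀ (P : Finset ι) (z : ι → ℝ) (K : ℕ),
      (P.card : ℝ) ≤ X ^ 2 → (closePairs P z : ℝ) ≤ X ^ (2 + ε) →
      (∀ p ∈ P, X ^ (a + 2 * ε) ≤ z p) → 1 ≤ K → (K : ℝ) ≤ X ^ a →
      dilateEnergy P z K H + (K * P.card : ℝ) ^ 2 * Real.exp (-(H : ℝ) ^ 2) ≤
        2 * X ^ (4 - ε / 2) := by
  obtain ⟨C, T₀, hC, henergy⟩ := exists_dilateEnergy_le_rpow (ι := ι) hκ hε hζ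
  filter_upwards [eventually_ge_atTop 1, (tendsto_rpow_atTop hε).eventually_ge_atTop T₀,
    eventually_const_mul_rpow_le 2 (show ε / 4 < ε by linarith),
    eventually_const_mul_rpow_le (C * 2) (show ε / 4 < ε / 2 by linarith),
    eventually_mul_sq_mul_exp_le a hε] with X hX hXT hHX hCX htail
  have hX0 : 0 < X := one_pos.trans_le hX
  have hone : 1 ≤ X ^ (ε / 4) := Real.one_le_rpow hX (by positivity)
  refine ⟨⌈X ^ (ε / 4)⌉₊, fun P z K hP hclose hz hK hKX => ?_⟩
  set H := ⌈X ^ (ε / 4)⌉₊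
  have hH : (H : ℝ) ≤ 2 * X ^ (ε / 4) := by
    linarith [Nat.ceil_lt_add_one (zero_le_one.trans hone)]
  have hdilate : (dilateEnergy P z K H : ℝ) ≤ X ^ (4 - ε / 2) :=
    calc (dilateEnergy P z K H : ℝ) ≤ C * H * X ^ (4 - ε) :=
          henergy P z X a K H hX hXT hK hKX (Nat.one_le_ceil_iff.2 (by linarith))
            (hH.trans hHX) hP hclose hz hexp
      _ ≤ X ^ (ε / 2) * X ^ (4 - ε) := by
          gcongr
          exact (mul_le_mul_of_nonneg_left hH hC.le).trans (by rwa [← mul_assoc])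
      _ = X ^ (4 - ε / 2) := by
          rw [← Real.rpow_add hX0]
          ring_nf
  linarith [htail H P.card K (Nat.le_ceil _) (Nat.cast_nonneg _) hP (Nat.cast_nonneg _) hKX]

theorem eventually_exists_dilateEnergy_farPairs_add_le {x : ℕ → ℝ}
    (henergy : ∀ᶠ N : ℕ in atTop, (addEnergy x N : ℝ) ≤ (N : ℝ) ^ (2 + ε))
    (hκ : 2 ≤ κ) (hε : 0 < ε) (hζ : ZetaMomentBound κ m) {a : ℝ}
    (hexp : a + (2 - a - 2 * ε) * (1 - κ / 2) + (2 * a + ε) * (m + ε) ≤ -ε) :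
    ∀ᶠ N : ℕ in atTop, ∃ H : ℕ, ∀ K : ℕ, 1 ≤ K → (K : ℝ) ≤ (N : ℝ) ^ a →
      dilateEnergy (farPairs x N ((N : ℝ) ^ (a + 2 * ε))) (pairDiff x) K H +
        (K * (farPairs x N ((N : ℝ) ^ (a + 2 * ε))).card : ℝ) ^ 2 * Real.exp (-(H : ℝ) ^ 2) ≤
        2 * (N : ℝ) ^ (4 - ε / 2) := by
  filter_upwards [henergy, tendsto_natCast_atTop_atTop.eventually
    (eventually_exists_dilateEnergy_add_le (ι := ℕ × ℕ) hκ hε hζ hexp)] with N hE ⟨H, hblock⟩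
  exact ⟨H, fun K => hblock _ (pairDiff x) K (mod_cast card_farPairs_le x N _)
    ((Nat.cast_le.2 (closePairs_pairDiff_le_addEnergy x (Finset.filter_subset _ _))).trans hE)
    fun p hp => (Finset.mem_filter.1 hp).2⟩

end PowerBounds

theorem mul_rpow_div_sq_le {X Q ε J : ℝ} (hX : 0 < X) (hQ : X ^ 2 / 4 ≤ Q)
    (hJ : 512 * J ^ 2 ≤ X ^ (ε / 4)) :
    16 * J ^ 2 * (2 * X ^ (4 - ε / 2)) / Q ^ 2 ≤ X ^ (-(ε / 4)) :=
  calc 16 * J ^ 2 * (2 * X ^ (4 - ε / 2)) / Q ^ 2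
      ≤ 16 * J ^ 2 * (2 * X ^ (4 - ε / 2)) / (X ^ 2 / 4) ^ 2 := by gcongr
    _ = 512 * J ^ 2 * X ^ (-(ε / 2)) := by
        rw [sub_eq_add_neg, Real.rpow_add hX, Real.rpow_ofNat]
        field_simp
        ring
    _ ≤ X ^ (ε / 4) * X ^ (-(ε / 2)) := by gcongr
    _ = X ^ (-(ε / 4)) := by
        rw [← Real.rpow_add hX]
        ring_nf

theorem exists_eventually_measure_le_metricMinGap_le {x : ℕ → ℝ}
    (henergy : ∀ ε : ℝ, 0 < ε → ∀ᶠ N : ℕ in atTop, (addEnergy x N : ℝ) ≤ (N : ℝ) ^ (2 + ε))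
    {κ m τ : ℝ} (hκ : 2 ≤ κ) (hζ : ZetaMomentBound κ m) (hτ : 0 ≤ τ)
    (hτκ : τ * (κ + 4 * m) < 2 * κ - 4) :
    ∃ θ : ℝ, 0 < θ ∧ ∀ᶠ N : ℕ in atTop,
      (gaussianReal 0 1).real {α | (N : ℝ) ^ (-τ) ≤ metricMinGap x α N} ≤ (N : ℝ) ^ (-θ) := by
  have hτ2 : τ < 2 := by nlinarith [mul_nonneg hτ (hζ.nonneg hκ)]
  obtain ⟨ε, hε, hτε, hexp⟩ := exists_small_exponent hτ2 hτκ
  obtain ⟨r, hkernel⟩ := exists_kernel_parameters (show τ < τ + ε by linarith)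
  have hlog := eventually_forall_const_mul_sq_le_rpow (show (0 : ℝ) ≤ 512 by norm_num) (τ + ε)
    (show 0 < ε / 4 by positivity)
  refine ⟨ε / 4, by positivity, ?_⟩
  filter_upwards [eventually_ge_atTop 1,
    eventually_sq_div_four_le_card_farPairs (by positivity) (henergy ε hε) hτε,
    eventually_exists_dilateEnergy_farPairs_add_le (henergy ε hε) hκ hε hζ hexp,
    tendsto_natCast_atTop_atTop.eventually hkernel, tendsto_natCast_atTop_atTop.eventually hlog]
    with N hN hfar ⟨H, hblock⟩ hkernel hlog
  set P := farPairs x N ((N : ℝ) ^ (τ + ε + 2 * ε))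
  have hN1 : (1 : ℝ) ≤ N := by exact_mod_cast hN
  have hN0 : (0 : ℝ) < N := one_pos.trans_le hN1
  have hP : P.Nonempty := Finset.card_pos.1 (Nat.cast_pos.1 (lt_of_lt_of_le (by positivity) hfar))
  obtain ⟨I, hI, hI'⟩ := exists_nat_pow_near (Real.one_le_rpow hN1 (show 0 ≤ τ + ε by positivity))
    one_lt_two
  obtain ⟨J, hJ, hδJ⟩ := hkernel (2 ^ I) (by positivity) (by exact_mod_cast hI)
    (by push_cast; rw [← pow_succ']; exact hI'.le)
  have hsub : {α | (N : ℝ) ^ (-τ) ≤ metricMinGap x α N} ⊆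
      {α | ∀ p ∈ P, (N : ℝ) ^ (-τ) ≤ distNearestInt (α * pairDiff x p)} := fun α hα p hp =>
    le_trans hα (metricMinGap_le_of_mem_farPairs (by positivity) hp α)
  have hbound := measure_forall_le_distNearestInt_le (pairDiff x) hP
    (Real.rpow_pos_of_pos hN0 (-τ)) hJ (by exact_mod_cast hδJ) (Nat.cast_nonneg H) fun i hi =>
      hblock (2 ^ i) Nat.one_le_two_pow
        (by push_cast; exact (pow_le_pow_right₀ one_le_two hi.le).trans hI)
  refine (measureReal_mono hsub).trans (hbound.trans ?_)
  exact mul_rpow_div_sq_le hN0 hfar (hlog I hI)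

/-! ### Almost every dilation -/

section MetricMinGap

variable {x : ℕ → ℝ} {α : ℝ}

theorem metricMinGap_anti {M N : ℕ} (hM : 2 ≤ M) (hMN : M ≤ N) :
    metricMinGap x α N ≤ metricMinGap x α M := by
  obtain ⟨m, hm, n, hn, hmn, h⟩ := (minGap_isLeast (fun n => α * x n) hM).1
  have hsub := Finset.Icc_subset_Icc_right (a := 1) hMN
  exact (minGap_isLeast (fun n => α * x n) (hM.trans hMN)).2 ⟨m, hsub hm, n, hsub hn, hmn, h⟩

theorem metricMinGap_nonneg (x : ℕ → ℝ) (α : ℝ) {N : ℕ} (hN : 2 ≤ N) :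
    0 ≤ metricMinGap x α N := by
  obtain ⟨m, -, n, -, -, h⟩ := (minGap_isLeast (fun n => α * x n) hN).1
  rw [metricMinGap, h]
  exact abs_nonneg _

theorem metricMinGap_le_half (x : ℕ → ℝ) (α : ℝ) {N : ℕ} (hN : 2 ≤ N) :
    metricMinGap x α N ≤ 1 / 2 := by
  obtain ⟨m, -, n, -, -, h⟩ := (minGap_isLeast (fun n => α * x n) hN).1
  rw [metricMinGap, h]
  exact abs_sub_round _

theorem eventually_metricMinGap_lt_of_two_pow {p q : ℝ} (hp : 0 ≤ p) (hpq : p < q)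
    (h : ∀ᶠ l : ℕ in atTop, metricMinGap x α (2 ^ l) < ((2 : ℝ) ^ l) ^ (-q)) :
    ∀ᶠ N : ℕ in atTop, metricMinGap x α N < (N : ℝ) ^ (-p) := by
  have hlog : Tendsto (fun N : ℕ => Nat.log 2 N) atTop atTop :=
    tendsto_atTop.2 fun b => by
      filter_upwards [eventually_ge_atTop (2 ^ b)] with N hN using
        Nat.le_log_of_pow_le one_lt_two hN
  filter_upwards [hlog.eventually h, hlog.eventually_ge_atTop 1, eventually_ge_atTop 1,
    tendsto_natCast_atTop_atTop.eventually
      (eventually_const_mul_rpow_le (2 ^ q) (neg_lt_neg hpq))] with N hgap hl hN hpow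
  set l := Nat.log 2 N
  have hN0 : (0 : ℝ) < N := by exact_mod_cast hN
  have hle : 2 ^ l ≤ N := Nat.pow_log_le_self 2 (by omega)
  have hhalf : (N : ℝ) / 2 ≤ 2 ^ l := by
    rw [div_le_iff₀ two_pos, ← pow_succ]
    exact_mod_cast (Nat.lt_pow_succ_log_self one_lt_two N).le
  calc metricMinGap x α N ≤ metricMinGap x α (2 ^ l) :=
        metricMinGap_anti (Nat.pow_le_pow_right two_pos hl) hle
    _ < ((2 : ℝ) ^ l) ^ (-q) := hgap
    _ ≤ ((N : ℝ) / 2) ^ (-q) :=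
        Real.rpow_le_rpow_of_nonpos (by positivity) hhalf (by linarith)
    _ = 2 ^ q * (N : ℝ) ^ (-q) := by
        rw [Real.div_rpow hN0.le two_pos.le, Real.rpow_neg two_pos.le, div_inv_eq_mul, mul_comm]
    _ ≤ (N : ℝ) ^ (-p) := hpow

end MetricMinGap

section AlmostEverywhere

theorem ae_eventually_notMem_of_measureReal_le_rpow {Ω : Type*} [MeasurableSpace Ω]
    {μ : Measure Ω} [IsFiniteMeasure μ] {s : ℕ → Set Ω} {θ : ℝ} (hθ : 0 < θ)
    (hs : ∀ᶠ l : ℕ in atTop, μ.real (s l) ≤ ((2 : ℝ) ^ l) ^ (-θ)) :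
    ∀ᵐ ω ∂μ, ∀ᶠ l : ℕ in atTop, ω ∉ s l := by
  have hgeom : Summable fun l : ℕ => ((2 : ℝ) ^ l) ^ (-θ) := by
    simp_rw [fun l : ℕ => Real.rpow_pow_comm (zero_le_two (α := ℝ)) (-θ) l |>.symm]
    exact summable_geometric_of_lt_one (by positivity)
      (Real.rpow_lt_one_of_one_lt_of_neg one_lt_two (neg_lt_zero.2 hθ))
  have hsum : Summable fun l : ℕ => μ.real (s l) :=
    .of_norm_bounded_eventually_nat hgeom
      (hs.mono fun l hl => by rwa [Real.norm_of_nonneg measureReal_nonneg])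
  refine ae_eventually_notMem ?_
  convert hsum.tsum_ofReal_ne_top with l
  rw [ofReal_measureReal]

theorem exists_eventually_lt_one_div_rpow {f : ℕ → ℝ} {e : ℝ} (hf : ∀ᶠ N : ℕ in atTop, 0 ≤ f N)
    (h : ∀ k : ℕ, ∀ᶠ N : ℕ in atTop, f N < (N : ℝ) ^ (-(e - 1 / ((k : ℝ) + 1)))) :
    ∃ o : ℕ → ℝ, Tendsto o atTop (𝓝 0) ∧ ∀ᶠ N : ℕ in atTop, f N < 1 / (N : ℝ) ^ (e - o N) := by
  -- Adding `N ^ (-e)` keeps the logarithm meaningful where `f` vanishes and makes `o` nonnegative.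
  set g : ℕ → ℝ := fun N => f N + (N : ℝ) ^ (-e)
  refine ⟨fun N => e + Real.logb N (g N), ?_, ?_⟩
  · refine tendsto_order.2 ⟨fun a ha => ?_, fun a ha => ?_⟩
    · filter_upwards [hf, eventually_gt_atTop 1] with N hfN hN
      have hN1 : (1 : ℝ) < N := by exact_mod_cast hN
      have hg : (N : ℝ) ^ (-e) ≤ g N := le_add_of_nonneg_left hfN
      have hlog := (Real.le_logb_iff_rpow_le hN1 (lt_of_lt_of_le (by positivity) hg)).2 hg
      linarith
    · obtain ⟨k, hk⟩ := exists_nat_one_div_lt ha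
      have hpos : (0 : ℝ) < 1 / ((k : ℝ) + 1) := Nat.one_div_pos_of_nat
      filter_upwards [hf, h k, eventually_gt_atTop 1, tendsto_natCast_atTop_atTop.eventually
        (eventually_const_mul_rpow_le 2 (show -(e - 1 / ((k : ℝ) + 1)) < -e + a by linarith))]
        with N hfN hlt hN hpow
      have hN1 : (1 : ℝ) < N := by exact_mod_cast hN
      have hle : (N : ℝ) ^ (-e) ≤ (N : ℝ) ^ (-(e - 1 / ((k : ℝ) + 1))) :=
        Real.rpow_le_rpow_of_exponent_le hN1.le (by linarith)
      have hlog : Real.logb N (g N) < -e + a :=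
        (Real.logb_lt_iff_lt_rpow hN1 (by positivity)).2 (by simp only [g]; linarith)
      linarith
  · filter_upwards [hf, eventually_gt_atTop 1] with N hfN hN
    have hN1 : (1 : ℝ) < N := by exact_mod_cast hN
    have hN0 : (0 : ℝ) < N := one_pos.trans hN1
    rw [one_div, ← Real.rpow_neg hN0.le, neg_sub, add_sub_cancel_left,
      Real.rpow_logb hN0 hN1.ne' (by positivity)]
    exact lt_add_of_pos_right _ (by positivity)

variable {x : ℕ → ℝ} {κ m τ : ℝ}

theorem ae_eventually_metricMinGap_two_pow_lt
    (henergy : ∀ ε : ℝ, 0 < ε → ∀ᶠ N : ℕ in atTop, (addEnergy x N : ℝ) ≤ (N : ℝ) ^ (2 + ε))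
    (hκ : 2 ≤ κ) (hζ : ZetaMomentBound κ m) (hτ : 0 ≤ τ) (hτκ : τ * (κ + 4 * m) < 2 * κ - 4) :
    ∀ᵐ α : ℝ ∂volume, ∀ᶠ l : ℕ in atTop, metricMinGap x α (2 ^ l) < ((2 : ℝ) ^ l) ^ (-τ) := by
  obtain ⟨θ, hθ, hmeasure⟩ :=
    exists_eventually_measure_le_metricMinGap_le henergy hκ hζ hτ hτκ
  have hbad := ae_eventually_notMem_of_measureReal_le_rpow hθ <| by
    simpa only [Nat.cast_pow, Nat.cast_ofNat] using
      (tendsto_pow_atTop_atTop_of_one_lt one_lt_two).eventually hmeasure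
  filter_upwards [(gaussianReal_absolutelyContinuous' 0 one_ne_zero).ae_le hbad] with α hα
  exact hα.mono fun l hl => not_le.1 hl

theorem ae_eventually_metricMinGap_lt
    (henergy : ∀ ε : ℝ, 0 < ε → ∀ᶠ N : ℕ in atTop, (addEnergy x N : ℝ) ≤ (N : ℝ) ^ (2 + ε))
    (hκ : 2 ≤ κ) (hζ : ZetaMomentBound κ m) (hτ : τ < (2 * κ - 4) / (κ + 4 * m)) :
    ∀ᵐ α : ℝ ∂volume, ∀ᶠ N : ℕ in atTop, metricMinGap x α N < (N : ℝ) ^ (-τ) := by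
  rcases lt_or_ge τ 0 with hneg | hnonneg
  · refine .of_forall fun α => ?_
    filter_upwards [eventually_ge_atTop 2] with N hN
    have hN1 : (1 : ℝ) ≤ N := by exact_mod_cast (by omega : 1 ≤ N)
    linarith [metricMinGap_le_half x α hN, Real.one_le_rpow hN1 (neg_nonneg.2 hneg.le)]
  · obtain ⟨τ', hττ', hτ'⟩ := exists_between hτ
    rw [lt_div_iff₀ (by linarith [hζ.nonneg hκ])] at hτ'
    filter_upwards [ae_eventually_metricMinGap_two_pow_lt henergy hκ hζ
      (hnonneg.trans hττ'.le) hτ'] with α hα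
    exact eventually_metricMinGap_lt_of_two_pow hnonneg hττ' hα

theorem theorem1p4_general
    (henergy : ∀ ε : ℝ, 0 < ε → ∀ᶠ N : ℕ in atTop, (addEnergy x N : ℝ) ≤ (N : ℝ) ^ (2 + ε))
    (hκ : 2 ≤ κ) (hζ : ZetaMomentBound κ m) :
    AEMinGapBound x ((2 * κ - 4) / (κ + 4 * m)) := by
  have hall : ∀ᵐ α : ℝ ∂volume, ∀ k : ℕ, ∀ᶠ N : ℕ in atTop, metricMinGap x α N <
      (N : ℝ) ^ (-((2 * κ - 4) / (κ + 4 * m) - 1 / ((k : ℝ) + 1))) :=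
    ae_all_iff.2 fun k => ae_eventually_metricMinGap_lt henergy hκ hζ
      (sub_lt_self _ Nat.one_div_pos_of_nat)
  filter_upwards [hall] with α hα
  exact exists_eventually_lt_one_div_rpow
    ((eventually_ge_atTop 2).mono fun N hN => metricMinGap_nonneg x α hN) hα

end AlmostEverywhere

theorem eventually_le_rpow_of_eq_rpow_add {f o : ℕ → ℝ} {a : ℝ} (ho : Tendsto o atTop (𝓝 0))
    (hf : ∀ᶠ N : ℕ in atTop, f N = (N : ℝ) ^ (a + o N)) {ε : ℝ} (hε : 0 < ε) :
    ∀ᶠ N : ℕ in atTop, f N ≤ (N : ℝ) ^ (a + ε) := by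
  filter_upwards [hf, ho.eventually_le_const hε, eventually_ge_atTop 1] with N hfN hoN hN
  rw [hfN]
  exact Real.rpow_le_rpow_of_exponent_le (by exact_mod_cast hN) (by linarith)

theorem theorem1p4 (x : ℕ → ℝ)
    (hpos : ∀ n : ℕ, 1 ≤ n → 0 < x n)
    (hgap : ∃ c : ℝ, 0 < c ∧ ∀ n : ℕ, 1 ≤ n → c ≤ x (n + 1) - x n)
    (henergy : ∃ o : ℕ → ℝ, Tendsto o atTop (𝓝 0) ∧
      ∀ᶠ N : ℕ in atTop, (addEnergy x N : ℝ) = (N : ℝ) ^ (2 + o N)) :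
    (∀ κ m : ℝ, 2 ≤ κ → ZetaMomentBound κ m →
      AEMinGapBound x ((2 * κ - 4) / (κ + 4 * m))) ∧
    (ZetaMomentBound 12 1 → AEMinGapBound x (5 / 4)) := by
  obtain ⟨o, ho, henergy⟩ := henergy
  have hbound := fun κ m => theorem1p4_general (κ := κ) (m := m) (x := x)
    fun _ => eventually_le_rpow_of_eq_rpow_add ho henergy
  refine ⟨hbound, fun hζ => ?_⟩
  convert hbound 12 1 (by norm_num) hζ using 1
  norm_num
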